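/- Let $V$ be an $n$-dimensional smooth projective toric variety over a field $k$, with (smooth, complete) fan $\Sigma_V$ in $\mathbb{R}^n$, and let $H\subset V$ be a hypersurface (a closed subscheme all of whose associated points have codimension one, for instance a smooth hypersurface) such that $\mathcal{O}_V(H)$ is ample. For a cone $\tau\in\Sigma_V$ of codimension one let $C_\tau\subset V$ be the corresponding torus-invariant curve and let $H\cdot C_\tau=\deg(\mathcal{O}_V(H)|_{C_\tau})$. A function $\mathbb{R}^n\to\mathbb{R}$ is called PL if its restriction to each maximal cone of $\Sigma_V$ is linear. A PL function $\psi$ has kink $\kappa$ across $\tau$ if $\ell'-\ell=\kappa\,\delta$, where $\ell,\ell'$ are the linear functions given by $\psi$ on the two maximal cones $\sigma,\sigma'$ containing $\tau$, and $\delta:\mathbb{Z}^n\to\mathbb{Z}$ is the surjection that vanishes on $\tau$ and is nonnegative on $\sigma'$. The hypersurface $H$ is linearly equivalent to a torus-invariant divisor $\sum_\rho a_\rho D_\rho$, where $\rho$ runs over the rays of $\Sigma_V$, with primitive generators $u_\rho$. For any such divisor let $$\Delta_V=\{x\in\mathbb{R}^n \mid \langle x,u_\rho\rangle\le a_\rho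 \text{ for all rays }\rho\}$$ be the moment polytope of $V$ for the polarization given by $H$ (another choice of the divisor translates $\Delta_V$; the rays of $\Sigma_V$ are outward normals to its facets). Its set $A$ of vertices is finite and nonempty. Let $\varphi(\xi)=\max_{a\in A}\langle a,\xi\rangle$ for $\xi\in\mathbb{R}^n$. Then: 1. $\varphi$ is a PL function on $\Sigma_V$ with kink $H\cdot C_\tau$ across every codimension-one cone $\tau$ of $\Sigma_V$; 2. if $\varphi_H:\mathbb{R}^n\to\mathbb{R}$ is any PL function on $\Sigma_V$ with kink $H\cdot C_\tau$ across every codimension-one cone $\tau$ of $\Sigma_V$, then $\varphi-\varphi_H$ is a linear function on $\mathbb{R}^n$. -/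

import Mathlib

open AlgebraicGeometry CategoryTheory CategoryTheory.Limits

universe u

noncomputable section

/-- The inclusion of the lattice `ℤⁿ` into `ℝⁿ`. -/
def latticeVec {n : ℕ} (u : Fin n → ℤ) : Fin n → ℝ := fun i => (u i : ℝ)

/-- The real cone generated by a finite set of lattice vectors. -/
def realCone {n : ℕ} (s : Finset (Fin n → ℤ)) : PointedCone ℝ (Fin n → ℝ) :=
  PointedCone.hull ℝ (latticeVec '' (s : Set (Fin n → ℤ)))

/-- A smooth fan in `ℝⁿ`. A smooth cone is recorded by the finite set of primitive generators of its
rays; these form a part of a basis of `ℤⁿ`, and the faces of the cone are the cones generated by the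
subsets. -/
structure SmoothFan (n : ℕ) where
  /-- the cones, each given by its set of primitive ray generators -/
  cones : Finset (Finset (Fin n → ℤ))
  smooth : ∀ s ∈ cones, ∃ b : Module.Basis (Fin n) ℤ (Fin n → ℤ),
    (s : Set (Fin n → ℤ)) ⊆ Set.range b
  face_mem : ∀ s ∈ cones, ∀ t ⊆ s, t ∈ cones
  inter_eq : ∀ s ∈ cones, ∀ t ∈ cones, realCone s ⊓ realCone t = realCone (s ∩ t)

/-- The characters of the torus that are regular on the affine toric variety of the cone `s`:
the lattice points of the dual cone. -/
def dualMonoid {n : ℕ} (s : Finset (Fin n → ℤ)) : AddSubmonoid (Fin n → ℤ) where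
  carrier := {m | ∀ u ∈ s, 0 ≤ m ⬝ᵥ u}
  zero_mem' := fun u _ => by simp
  add_mem' := fun {a b} ha hb u hu => by
    rw [add_dotProduct]
    exact add_nonneg (ha u hu) (hb u hu)

/-- The ring of regular functions of the torus: Laurent polynomials in `n` variables. -/
abbrev TorusRing (k : Type u) [Field k] (n : ℕ) : Type u := AddMonoidAlgebra k (Fin n → ℤ)

/-- The character `χᵐ`. -/
def character (k : Type u) [Field k] {n : ℕ} (m : Fin n → ℤ) : TorusRing k n :=
  AddMonoidAlgebra.single m 1

/-- The coordinate ring `k[σ^∨ ∩ ℤⁿ]` of the affine toric variety of the cone `s`: the Laurent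
polynomials all of whose characters lie in the dual cone. -/
def chartRing (k : Type u) [Field k] {n : ℕ} (s : Finset (Fin n → ℤ)) :
    Subalgebra k (TorusRing k n) where
  carrier := {f | ∀ m ∈ f.coeff.support, m ∈ dualMonoid s}
  mul_mem' := fun {f g} hf hg m hm => by
    classical
    obtain ⟨a, ha, b, hb, rfl⟩ := Finset.mem_add.1 (AddMonoidAlgebra.support_coeff_mul_subset f g hm)
    exact add_mem (hf a ha) (hg b hb)
  add_mem' := fun {f g} hf hg m hm => by
    classical
    rcases Finset.mem_union.1 (Finsupp.support_add hm) with h | h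
    · exact hf m h
    · exact hg m h
  algebraMap_mem' := fun r m hm => by
    have h : m ∈ (Finsupp.single (0 : Fin n → ℤ) r).support := hm
    rw [Finset.mem_singleton.1 (Finsupp.support_single_subset h)]
    exact zero_mem _

theorem character_mem {k : Type u} [Field k] {n : ℕ} {s : Finset (Fin n → ℤ)} {m : Fin n → ℤ}
    (hm : m ∈ dualMonoid s) : character k m ∈ chartRing k s := fun a ha => by
  have h : a ∈ (Finsupp.single m (1 : k)).support := ha
  rw [Finset.mem_singleton.1 (Finsupp.support_single_subset h)]
  exact hm

theorem character_mul {k : Type u} [Field k] {n : ℕ} (a b : Fin n → ℤ) :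
    character k a * character k b = character k (a + b) := by
  simp [character]

theorem character_pow {k : Type u} [Field k] {n : ℕ} (a : Fin n → ℤ) (N : ℕ) :
    character k a ^ N = character k (N • a) := by
  simp [character, AddMonoidAlgebra.single_pow]

theorem chartRing_anti (k : Type u) [Field k] {n : ℕ} {s t : Finset (Fin n → ℤ)} (h : s ⊆ t) :
    chartRing k t ≤ chartRing k s :=
  fun _ hf m hm u hu => hf m hm u (h hu)

/-- `k[t^∨ ∩ ℤⁿ] → k[s^∨ ∩ ℤⁿ]` for a face `s` of `t`. -/
def chartIncl (k : Type u) [Field k] {n : ℕ} {s t : Finset (Fin n → ℤ)} (h : s ⊆ t) :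
    chartRing k t →+* chartRing k s :=
  (Subalgebra.inclusion (chartRing_anti k h)).toRingHom

theorem chartIncl_isLocalization (k : Type u) [Field k] {n : ℕ} {s t : Finset (Fin n → ℤ)}
    (h : s ⊆ t) (m : Fin n → ℤ) (hm : m ∈ dualMonoid t) (h0 : ∀ u ∈ s, m ⬝ᵥ u = 0)
    (h1 : ∀ u ∈ t, u ∉ s → 1 ≤ m ⬝ᵥ u) :
    letI := (chartIncl k h).toAlgebra
    IsLocalization.Away (⟨character k m, character_mem hm⟩ : chartRing k t) (chartRing k s) := by
  let := (chartIncl k h).toAlgebra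
  refine IsLocalization.Away.mk _ ?_ ?_ ?_
  · refine IsUnit.of_mul_eq_one (⟨character k (-m), character_mem fun u hu => ?_⟩ : chartRing k s) ?_
    · simp [h0 u hu]
    · apply Subtype.ext
      change character k m * character k (-m) = 1
      rw [character_mul, add_neg_cancel]
      rfl
  · rintro ⟨f, hf⟩
    classical
    let N : ℕ := ∑ a ∈ f.coeff.support, ∑ u ∈ t, (a ⬝ᵥ u).natAbs
    refine ⟨N, ⟨f * character k m ^ N, ?_⟩, rfl⟩
    intro b hb
    rw [character_pow] at hb
    obtain ⟨a, ha, c, hc, rfl⟩ := Finset.mem_add.1 (AddMonoidAlgebra.support_coeff_mul_subset _ _ hb)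
    have hc' : c ∈ (Finsupp.single (N • m) (1 : k)).support := hc
    rw [Finset.mem_singleton.1 (Finsupp.support_single_subset hc')]
    intro u hu
    rw [add_dotProduct, smul_dotProduct]
    by_cases hus : u ∈ s
    · rw [h0 u hus]
      simpa using hf a ha u hus
    · have hN : (a ⬝ᵥ u).natAbs ≤ N :=
        (Finset.single_le_sum (f := fun u => (a ⬝ᵥ u).natAbs) (fun _ _ => Nat.zero_le _) hu).trans
          (Finset.single_le_sum (f := fun a => ∑ u ∈ t, (a ⬝ᵥ u).natAbs)
            (fun _ _ => Nat.zero_le _) ha)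
      have h2 := h1 u hu hus
      have h3 : (N : ℤ) ≤ N * (m ⬝ᵥ u) := le_mul_of_one_le_right (by positivity) h2
      rw [nsmul_eq_mul]
      omega
  · intro a b hab
    refine ⟨0, ?_⟩
    have : a = b := Subtype.ext (congrArg (fun z : chartRing k s => (z : TorusRing k n)) hab)
    rw [this]

namespace SmoothFan

variable {n : ℕ} (F : SmoothFan n)

theorem exists_separating {t : Finset (Fin n → ℤ)} (ht : t ∈ F.cones) (s : Finset (Fin n → ℤ)) :
    ∃ m : Fin n → ℤ, m ∈ dualMonoid t ∧ (∀ u ∈ t, u ∈ s → m ⬝ᵥ u = 0) ∧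
      ∀ u ∈ t, u ∉ s → 1 ≤ m ⬝ᵥ u := by
  classical
  obtain ⟨b, hb⟩ := F.smooth t ht
  let l : (Fin n → ℤ) →ₗ[ℤ] ℤ := b.constr ℤ (fun i => if b i ∈ s then (0 : ℤ) else 1)
  have hl : ∀ u, (fun i => l (Pi.single i 1)) ⬝ᵥ u = l u := fun u => by
    rw [LinearMap.pi_apply_eq_sum_univ l u]
    refine Finset.sum_congr rfl fun i _ => ?_
    have : (fun j => if i = j then (1 : ℤ) else 0) = Pi.single i 1 := by
      ext j
      simp [Pi.single_apply, eq_comm]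
    rw [this, smul_eq_mul, mul_comm]
  have hu : ∀ u ∈ t, l u = if u ∈ s then (0 : ℤ) else 1 := fun u hu => by
    obtain ⟨i, rfl⟩ := hb hu
    exact b.constr_basis ℤ _ i
  refine ⟨fun i => l (Pi.single i 1), fun u h => ?_, fun u h h' => ?_, fun u h h' => ?_⟩
  · rw [hl, hu u h]; split_ifs <;> simp
  · rw [hl, hu u h, if_pos h']
  · rw [hl, hu u h, if_neg h']

/-- The affine charts `Spec k[σ^∨ ∩ ℤⁿ]` of the cones of the fan and the inclusions given by
the faces. -/
def chartDiagram (k : Type u) [Field k] : {s // s ∈ F.cones} ⥤ Scheme.{u} where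
  obj s := Spec (CommRingCat.of (chartRing k s.1))
  map f := Spec.map (CommRingCat.ofHom (chartIncl k f.le))
  map_id s := Spec.map_id _
  map_comp f g := by
    rw [← Spec.map_comp]
    rfl

instance (k : Type u) [Field k] {s t : {s // s ∈ F.cones}} (f : s ⟶ t) :
    IsOpenImmersion ((F.chartDiagram k).map f) := by
  obtain ⟨m, hm, h0, h1⟩ := F.exists_separating t.2 s.1
  let := (chartIncl k f.le).toAlgebra
  have := chartIncl_isLocalization k f.le m hm (fun u hu => h0 u (f.le hu) hu) h1
  exact IsOpenImmersion.of_isLocalization (S := chartRing k s.1)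
    (⟨character k m, character_mem hm⟩ : chartRing k t.1)

instance (k : Type u) [Field k] : (F.chartDiagram k ⋙ Scheme.forget).IsLocallyDirected where
  cond := by
    intro i j l fi fj xi xj hx
    let p : {s // s ∈ F.cones} := ⟨i.1 ∩ j.1, F.face_mem _ i.2 _ Finset.inter_subset_left⟩
    let gi : p ⟶ i := homOfLE (show i.1 ∩ j.1 ⊆ i.1 from Finset.inter_subset_left)
    let gj : p ⟶ j := homOfLE (show i.1 ∩ j.1 ⊆ j.1 from Finset.inter_subset_right)
    obtain ⟨m, hm, h0, h1⟩ := F.exists_separating l.2 j.1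
    have hmi : m ∈ dualMonoid i.1 := fun u hu => hm u (fi.le hu)
    have hx' : (F.chartDiagram k).map fi xi = (F.chartDiagram k).map fj xj := hx
    have key : ∃ z, (F.chartDiagram k).map gi z = xi := by
      let := (chartIncl k gi.le).toAlgebra
      have := chartIncl_isLocalization k gi.le m hmi
        (fun u hu => h0 u (fj.le (gj.le hu)) (gj.le hu))
        (fun u hu hup => h1 u (fi.le hu) fun huj => hup (Finset.mem_inter.2 ⟨hu, huj⟩))
      have hr := PrimeSpectrum.localization_away_comap_range (chartRing k p.1)
        (⟨character k m, character_mem hmi⟩ : chartRing k i.1)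
      have hxi : xi ∈ Set.range (PrimeSpectrum.comap
          (algebraMap (chartRing k i.1) (chartRing k p.1))) := by
        rw [hr]
        intro hmem
        have h2 : (⟨character k m, character_mem hm⟩ : chartRing k l.1) ∈
            PrimeSpectrum.asIdeal ((F.chartDiagram k).map fi xi) := hmem
        rw [hx'] at h2
        have h3 : (⟨character k m, character_mem fun u hu => hm u (fj.le hu)⟩ : chartRing k j.1) ∈
            PrimeSpectrum.asIdeal xj := h2
        refine (PrimeSpectrum.isPrime xj).ne_top (Ideal.eq_top_of_isUnit_mem _ h3 ?_)
        refine IsUnit.of_mul_eq_one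
          (⟨character k (-m), character_mem fun u hu => ?_⟩ : chartRing k j.1) ?_
        · simp [h0 u (fj.le hu) hu]
        · apply Subtype.ext
          change character k m * character k (-m) = 1
          rw [character_mul, add_neg_cancel]
          rfl
      exact hxi
    obtain ⟨z, hz⟩ := key
    refine ⟨p, gi, gj, z, hz, ?_⟩
    apply ((F.chartDiagram k).map fj).isOpenEmbedding.injective
    change (F.chartDiagram k).map fj ((F.chartDiagram k).map gj z) = (F.chartDiagram k).map fj xj
    rw [← hx', ← hz, ← Scheme.Hom.comp_apply, ← Scheme.Hom.comp_apply, ← Functor.map_comp,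
      ← Functor.map_comp, Subsingleton.elim (gj ≫ fj) (gi ≫ fi)]

/-- The toric variety of the fan: the affine charts glued along the charts of common faces. -/
def toricVariety (k : Type u) [Field k] : Scheme.{u} := colimit (F.chartDiagram k)

/-- The inclusion of the affine chart `U_σ = Spec k[σ^∨ ∩ ℤⁿ]`. -/
def chart (k : Type u) [Field k] (s : {s // s ∈ F.cones}) :
    Spec (CommRingCat.of (chartRing k s.1)) ⟶ F.toricVariety k :=
  colimit.ι (F.chartDiagram k) s

instance (k : Type u) [Field k] (s : {s // s ∈ F.cones}) : IsOpenImmersion (F.chart k s) :=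
  inferInstanceAs (IsOpenImmersion (colimit.ι (F.chartDiagram k) s))

/-- The fan is complete: its cones cover `ℝⁿ`. -/
def IsComplete : Prop := ∀ x : Fin n → ℝ, ∃ s ∈ F.cones, x ∈ realCone s

/-! ### Closed subschemes, divisors and ampleness

The function field of the toric variety is that of the torus, and the rings of the affine charts,
as well as the invertible sheaves attached to divisors, are seen inside it. -/

/-- The function field of the torus, hence of the toric variety. -/
abbrev _root_.TorusField (k : Type u) [Field k] (n : ℕ) : Type u := FractionRing (TorusRing k n)

variable {F} {k : Type u} [Field k]

/-- The sections over the affine chart `U_σ` of a quasi-coherent ideal sheaf, as an ideal of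
`k[σ^∨ ∩ ℤⁿ]`. -/
def idealOn (I : (F.toricVariety k).IdealSheafData) (s : {s // s ∈ F.cones}) :
    Ideal (chartRing k s.1) :=
  (I.ideal ⟨(F.chart k s).opensRange, isAffineOpen_opensRange (F.chart k s)⟩).map
    ((F.chart k s).appLE (F.chart k s).opensRange ⊤ (by simp) ≫
      (Scheme.ΓSpecIso (CommRingCat.of (chartRing k s.1))).hom).hom

/-- The closed subscheme with ideal sheaf `I` is a hypersurface: all its associated points
have codimension one. A smooth closed subscheme of pure codimension one is an example. -/
def IsHypersurface (I : (F.toricVariety k).IdealSheafData) : Prop :=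
  ∀ s : {s // s ∈ F.cones}, ∀ P : Ideal (chartRing k s.1),
    P ∈ associatedPrimes (chartRing k s.1) (chartRing k s.1 ⧸ idealOn I s) → P.height = 1

/-- The sections over `U_σ` of `𝒪(dH)`, where `H` is the hypersurface with ideal sheaf `I`: the
rational functions `f` with `f · I^d ⊆ 𝒪`. -/
def sheafO (I : (F.toricVariety k).IdealSheafData) (d : ℕ) (s : {s // s ∈ F.cones}) :
    Submodule (chartRing k s.1) (TorusField k n) :=
  1 / (IsLocalization.coeSubmodule (TorusField k n) (idealOn I s)) ^ d

/-- The sections over `U_σ` of `J ⊗ 𝒪(dH)`, for an ideal sheaf `J`. -/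
def twistedIdeal (J I : (F.toricVariety k).IdealSheafData) (d : ℕ) (s : {s // s ∈ F.cones}) :
    Submodule (chartRing k s.1) (TorusField k n) :=
  IsLocalization.coeSubmodule (TorusField k n) (idealOn J s) * sheafO I d s

/-- The global sections of `J ⊗ 𝒪(dH)`. -/
def globalSections (J I : (F.toricVariety k).IdealSheafData) (d : ℕ) : Set (TorusField k n) :=
  {f | ∀ s, f ∈ twistedIdeal J I d s}

/-- `𝒪(H)` is ample: for every coherent ideal sheaf `J`, the sheaf `J ⊗ 𝒪(dH)` is generated by
its global sections for all large `d` (Serre; EGA II, 4.5.5). -/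
def IsAmple (I : (F.toricVariety k).IdealSheafData) : Prop :=
  ∀ J : (F.toricVariety k).IdealSheafData, ∃ d₀ : ℕ, ∀ d ≥ d₀, ∀ s,
    twistedIdeal J I d s ≤ Submodule.span (chartRing k s.1) (globalSections J I d)

/-! ### The moment polytope -/

/-- The sections over `U_σ` of the ideal `𝒪(-D)` of the torus-invariant divisor `D = ∑ a_ρ D_ρ`;
the character `χᵐ` vanishes along `D_ρ` to the order `⟨m, u_ρ⟩`. Here `a_ρ = a u_ρ` for the primitive
generator `u_ρ` of the ray `ρ`. -/
def invariantIdeal (k : Type u) [Field k] (a : (Fin n → ℤ) → ℤ) (s : {s // s ∈ F.cones}) :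
    Submodule (chartRing k s.1) (TorusField k n) :=
  Submodule.span (chartRing k s.1)
    {f | ∃ m : Fin n → ℤ, (∀ u ∈ s.1, a u ≤ m ⬝ᵥ u) ∧
      f = algebraMap (TorusRing k n) (TorusField k n) (character k m)}

/-- The hypersurface `H` with ideal sheaf `I` is linearly equivalent to the torus-invariant divisor
`D = ∑ a_ρ D_ρ`: `𝒪(-H) = g · 𝒪(-D)` for a nonzero rational function `g`. -/
def IsLinearlyEquivalent (I : (F.toricVariety k).IdealSheafData) (a : (Fin n → ℤ) → ℤ) : Prop :=
  ∃ g : (TorusField k n)ˣ, ∀ s, IsLocalization.coeSubmodule (TorusField k n) (idealOn I s) =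
    Submodule.span (chartRing k s.1) {(g : TorusField k n)} * invariantIdeal k a s

/-- `Δ` is a moment polytope of the toric variety for the polarization `𝒪(H)`: the polytope
`{x | ⟨x, u_ρ⟩ ≤ a_ρ for all rays ρ}` of a torus-invariant divisor `∑ a_ρ D_ρ` linearly equivalent
to `H`. The rays of the fan are the outward normals of its facets. The choice of the divisor changes
the polytope by a translation. -/
def IsMomentPolytope (I : (F.toricVariety k).IdealSheafData) (Δ : Set (Fin n → ℝ)) : Prop :=
  ∃ a : (Fin n → ℤ) → ℤ, IsLinearlyEquivalent I a ∧
    Δ = {x | ∀ u : Fin n → ℤ, {u} ∈ F.cones → x ⬝ᵥ latticeVec u ≤ a u}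

/-! ### The intersection number with the curve of a codimension-one cone -/

variable (F) in
/-- `τ` is a cone of codimension one, and `σ`, `σ'` are the two maximal cones that contain it. -/
structure IsWall (τ σ σ' : {s // s ∈ F.cones}) : Prop where
  card_wall : τ.1.card + 1 = n
  card_left : σ.1.card = n
  card_right : σ'.1.card = n
  ne : σ ≠ σ'
  le_left : τ.1 ⊆ σ.1
  le_right : τ.1 ⊆ σ'.1

/-- The ideal in `U_σ`, for a cone `σ ⊇ τ`, of the closure of the torus orbit of `τ`: it is generated
by the characters regular on `U_σ` that are not orthogonal to `τ`. When `τ` has codimension one this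
closure is the curve `C_τ`. -/
def orbitClosureIdeal (k : Type u) [Field k] (τ s : {s // s ∈ F.cones}) :
    Ideal (chartRing k s.1) :=
  Ideal.span {f | ∃ m ∈ dualMonoid s.1, (∃ u ∈ τ.1, m ⬝ᵥ u ≠ 0) ∧
    (f : TorusRing k n) = character k m}

/-- The sections of `𝒪(dH)` over `U_σ`, as a vector space over `k`. -/
def sectionsO (I : (F.toricVariety k).IdealSheafData) (d : ℕ) (s : {s // s ∈ F.cones}) :
    Submodule k (TorusField k n) :=
  (sheafO I d s).restrictScalars k

/-- The sections of `𝒪(dH)` over `U_σ` that restrict to zero on `C_τ`: those of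
`I_{C_τ} · 𝒪(dH)`. Hence `sectionsO I d s` modulo `vanishingO I d τ s` is the space of sections over
`U_σ ∩ C_τ` of the restriction of `𝒪(dH)` to `C_τ`. -/
def vanishingO (I : (F.toricVariety k).IdealSheafData) (d : ℕ) (τ s : {s // s ∈ F.cones}) :
    Submodule k (TorusField k n) :=
  (IsLocalization.coeSubmodule (TorusField k n) (orbitClosureIdeal k τ s) *
    sheafO I d s).restrictScalars k

/-- Pairs of sections of `𝒪(dH)` over `U_σ` and over `U_σ'` that agree on `U_τ ∩ C_τ`. -/
def cechCocycles (I : (F.toricVariety k).IdealSheafData) (d : ℕ) (τ σ σ' : {s // s ∈ F.cones}) :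
    Submodule k (TorusField k n × TorusField k n) :=
  (sectionsO I d σ).prod (sectionsO I d σ') ⊓
    (vanishingO I d τ τ).comap
      (LinearMap.fst k (TorusField k n) (TorusField k n) -
        LinearMap.snd k (TorusField k n) (TorusField k n))

/-- `H⁰(C_τ, 𝒪(dH)|_{C_τ})`, computed by the Čech complex of the affine open cover of `C_τ` by
`U_σ ∩ C_τ` and `U_σ' ∩ C_τ`, whose intersection is `U_τ ∩ C_τ`. -/
abbrev CechH0 (I : (F.toricVariety k).IdealSheafData) (d : ℕ) (τ σ σ' : {s // s ∈ F.cones}) :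
    Type u :=
  cechCocycles I d τ σ σ' ⧸
    ((vanishingO I d τ σ).prod (vanishingO I d τ σ')).submoduleOf (cechCocycles I d τ σ σ')

/-- `H¹(C_τ, 𝒪(dH)|_{C_τ})`, computed by the same Čech complex. -/
abbrev CechH1 (I : (F.toricVariety k).IdealSheafData) (d : ℕ) (τ σ σ' : {s // s ∈ F.cones}) :
    Type u :=
  sectionsO I d τ ⧸
    (sectionsO I d σ ⊔ sectionsO I d σ' ⊔ vanishingO I d τ τ).submoduleOf (sectionsO I d τ)

/-- The Euler characteristic of the restriction of `𝒪(dH)` to `C_τ`. -/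
def eulerChar (I : (F.toricVariety k).IdealSheafData) (d : ℕ) (τ σ σ' : {s // s ∈ F.cones}) : ℤ :=
  (Module.finrank k (CechH0 I d τ σ σ') : ℤ) - (Module.finrank k (CechH1 I d τ σ σ') : ℤ)

/-- The intersection number `H · C_τ`: the degree `χ(L) - χ(𝒪_C)` of the restriction `L` of `𝒪(H)`
to the complete curve `C = C_τ`. -/
def intersectionNumber (I : (F.toricVariety k).IdealSheafData) (τ σ σ' : {s // s ∈ F.cones}) : ℤ :=
  eulerChar I 1 τ σ σ' - eulerChar I 0 τ σ σ'

/-! ### Piecewise linear functions and kinks -/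

variable (F) in
/-- A piecewise linear function on the fan: it is linear on every maximal cone. -/
def IsPL (φ : (Fin n → ℝ) → ℝ) : Prop :=
  ∀ s ∈ F.cones, s.card = n →
    ∃ l : (Fin n → ℝ) →ₗ[ℝ] ℝ, ∀ x ∈ realCone s, φ x = l x

/-- `φ` has kink `κ` across `τ`, the common face of the maximal cones `σ` and `σ'`: if `l` and `l'`
are the slopes of `φ` on `σ` and `σ'`, and `δ : ℤⁿ → ℤ` is the quotient by the sublattice spanned by
`τ`, with the sign that makes it nonnegative on `σ'`, then `l' - l = κ δ`. -/
def HasKink (φ : (Fin n → ℝ) → ℝ) (τ σ σ' : {s // s ∈ F.cones}) (κ : ℝ) : Prop :=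
  ∃ (l l' : (Fin n → ℝ) →ₗ[ℝ] ℝ) (δ : Fin n → ℤ),
    (∀ x ∈ realCone σ.1, φ x = l x) ∧ (∀ x ∈ realCone σ'.1, φ x = l' x) ∧
    (∀ u ∈ τ.1, δ ⬝ᵥ u = 0) ∧ Function.Surjective (fun u : Fin n → ℤ => δ ⬝ᵥ u) ∧
    (∀ u ∈ σ'.1, 0 ≤ δ ⬝ᵥ u) ∧
    ∀ x, l' x - l x = κ * (latticeVec δ ⬝ᵥ x)

/-- A piecewise linear function with kink `H · C_τ` across every cone `τ` of codimension one. -/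
def HasIntersectionKinks (I : (F.toricVariety k).IdealSheafData) (φ : (Fin n → ℝ) → ℝ) : Prop :=
  F.IsPL φ ∧ ∀ τ σ σ', F.IsWall τ σ σ' → HasKink φ τ σ σ' (intersectionNumber I τ σ σ')

end SmoothFan

end

/-! The ring of a smooth affine chart is a localization of a polynomial ring, hence factorial, so
`H` has a single equation there. Over the torus these equations differ by units, that is, by
monomials up to scalars (`torusRing_isUnit`). Hence `H` is linearly equivalent to an invariant
divisor with coefficients a, and each cone s carries a lattice point m_s with ⟨m_s, u⟩ = a_u on its
rays.

Up to a fixed factor, the sections of 𝒪(dH) over U_s are the Laurent polynomials whose exponents p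
satisfy ⟨p, u⟩ ≥ -d a_u for u in s, so cohomology becomes a count of exponents. If 𝒪(H) is ample and
σ is maximal, the local generator χ^{-d m_σ} must occur in some global section, which puts m_σ in
the polytope (`IsAmple.dotProduct_le`). For a wall with m_σ' - m_σ = κδ, the exponents -d m_σ - tδ
with 0 ≤ t ≤ dκ index a basis of H⁰ on the curve, and H¹ = 0. So χ = dκ + 1 and H · C_τ = κ
(`intersectionNumber_eq`).

The vertices of the polytope are the m_σ for maximal σ, and m_σ maximizes ⟨·, ξ⟩ when ξ ∈ σ. Thus φ
has slope m_σ on σ and kink κ across the wall. For uniqueness, the difference of two PL functions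
with equal kinks has the same slope on both sides of every wall. A generic segment between two
maximal cones misses all cones of codimension at least two, so the slope is the same everywhere
(`IsComplete.eq_of_forall_isWall`). -/

/-! ### Ideals of pure codimension one in factorial rings -/

/-- Dividing generators by their gcd `f` gives I = f J with the generators of J coprime. If J were
proper, multiplication by `f` would embed R/J into R/I, so an associated prime of R/J would have
height one. In a factorial ring it would be principal, generated by a common divisor of coprime
elements. -/
theorem Ideal.isPrincipal_of_forall_height_associatedPrimes_eq_one {R : Type*} [CommRing R]
    [IsDomain R] [IsNoetherianRing R] [UniqueFactorizationMonoid R] (I : Ideal R)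
    (hI : ∀ P ∈ associatedPrimes R (R ⧸ I), P.height = 1) : I.IsPrincipal := by
  classical
  by_cases hI0 : I = ⊥
  · rw [hI0]; infer_instance
  obtain ⟨S, hS⟩ := IsNoetherian.noetherian I
  let := UniqueFactorizationMonoid.strongNormalizationMonoid (α := R)
  let := UniqueFactorizationMonoid.toNormalizedGCDMonoid R
  have hSn : S.Nonempty := by
    rw [Finset.nonempty_iff_ne_empty]
    rintro rfl
    exact hI0 (by rw [← hS]; simp)
  obtain ⟨g, hg, hg1⟩ := Finset.extract_gcd id hSn
  set f := S.gcd id with hf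
  have hf0 : f ≠ 0 := by
    intro h
    apply hI0
    rw [← hS, Submodule.span_eq_bot]
    intro x hx
    have := hg x hx
    simpa [h] using this
  let J : Ideal R := Ideal.span (g '' S)
  have hIJ : ∀ y, f * y ∈ I ↔ y ∈ J := by
    have hI' : I = Ideal.span {f} * J := by
      rw [← hS, Ideal.span_mul_span', Set.singleton_mul, Set.image_image]
      congr 1
      ext x
      constructor
      · intro hx
        exact ⟨x, hx, (hg x hx).symm⟩
      · rintro ⟨y, hy, rfl⟩
        have := hg y hy
        simp only [id] at this
        change f * g y ∈ S
        rw [← this]; exact hy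
    intro y
    rw [hI', Ideal.mem_span_singleton_mul]
    constructor
    · rintro ⟨z, hz, h⟩
      rwa [← mul_left_cancel₀ hf0 h]
    · exact fun h => ⟨y, h, rfl⟩
  have hJ : J = ⊤ := by
    by_contra hne
    have : Nontrivial (R ⧸ J) := Ideal.Quotient.nontrivial_iff.2 hne
    obtain ⟨P, hP⟩ := associatedPrimes.nonempty R (R ⧸ J)
    let φ : (R ⧸ J) →ₗ[R] (R ⧸ I) :=
      Submodule.mapQ J I (LinearMap.mulLeft R f) fun y hy => (hIJ y).2 hy
    have hφ : Function.Injective φ := by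
      rw [← LinearMap.ker_eq_bot, LinearMap.ker_eq_bot']
      intro y
      obtain ⟨y, rfl⟩ := Submodule.Quotient.mk_surjective _ y
      intro h
      have h : (Submodule.Quotient.mk (f * y) : R ⧸ I) = 0 := h
      rw [Submodule.Quotient.mk_eq_zero] at h ⊢
      exact (hIJ y).1 h
    have hPI := associatedPrimes.subset_of_injective hφ hP
    have hPp : P.IsPrime := hP.isPrime
    have hp := UniqueFactorizationMonoid.isPrincipal_of_height_eq_one (hI P hPI)
    obtain ⟨p, rfl⟩ := hp
    have hJP : J ≤ Ideal.span {p} := by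
      have := IsAssociatedPrime.annihilator_le hP
      rwa [Submodule.annihilator_top, Ideal.annihilator_quotient] at this
    have hpd : p ∣ S.gcd g := Finset.dvd_gcd fun x hx =>
      Ideal.mem_span_singleton.1 (hJP (Ideal.subset_span ⟨x, hx, rfl⟩))
    rw [hg1] at hpd
    exact hPp.ne_top ((Ideal.span_singleton_eq_top).2 (isUnit_of_dvd_one hpd))
  refine ⟨f, ?_⟩
  ext y
  change _ ↔ y ∈ Ideal.span {f}
  rw [Ideal.mem_span_singleton]
  constructor
  · intro hy
    rw [← hS] at hy
    have h2 : Ideal.span (S : Set R) ≤ Ideal.span {f} := Ideal.span_le.2 fun x hx =>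
      Ideal.mem_span_singleton.2 (Finset.gcd_dvd (f := id) hx)
    exact Ideal.mem_span_singleton.1 (h2 hy)
  · rintro ⟨z, rfl⟩
    rw [hIJ, hJ]; trivial

/-! ### Units of the Laurent polynomial ring -/

/-- A sum of exponents attained by only one pair has a coefficient that cannot cancel, and
`TwoUniqueSums` supplies two such pairs. -/
theorem AddMonoidAlgebra.support_coeff_mul_nontrivial {R G : Type*} [Ring R] [NoZeroDivisors R]
    [AddCommGroup G] [TwoUniqueSums G] (f g : AddMonoidAlgebra R G)
    (h : 1 < f.coeff.support.card * g.coeff.support.card) :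
    ∃ a ∈ (f * g).coeff.support, ∃ b ∈ (f * g).coeff.support, a ≠ b := by
  obtain ⟨p, hp, q, hq, hne, hup, huq⟩ := TwoUniqueSums.uniqueAdd_of_one_lt_card h
  rw [Finset.mem_product] at hp hq
  have key : ∀ r : G × G, r.1 ∈ f.coeff.support → r.2 ∈ g.coeff.support →
      UniqueAdd f.coeff.support g.coeff.support r.1 r.2 →
      r.1 + r.2 ∈ (f * g).coeff.support := by
    intro r h1 h2 hu
    rw [Finsupp.mem_support_iff] at h1 h2 ⊢
    rw [AddMonoidAlgebra.coeff_mul_add_of_uniqueAdd hu]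
    exact mul_ne_zero h1 h2
  refine ⟨_, key p hp.1 hp.2 hup, _, key q hq.1 hq.2 huq, fun he => hne ?_⟩
  have := hup hq.1 hq.2 he.symm
  exact Prod.ext this.1.symm this.2.symm

/-- The product 1 has a single exponent, so a unit and its inverse both have one-point support. -/
theorem torusRing_isUnit {k : Type u} [Field k] {n : ℕ} {f : TorusRing k n} (hf : IsUnit f) :
    ∃ (m : Fin n → ℤ) (c : k), c ≠ 0 ∧ f = AddMonoidAlgebra.single m c := by
  obtain ⟨g, hg⟩ := hf.exists_right_inv
  have hs : (f * g).coeff.support ⊆ {0} := by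
    rw [hg]
    exact Finsupp.support_single_subset
  have h1 : ¬ 1 < f.coeff.support.card * g.coeff.support.card := by
    intro h
    obtain ⟨a, ha, b, hb, hab⟩ := AddMonoidAlgebra.support_coeff_mul_nontrivial f g h
    exact hab ((Finset.mem_singleton.1 (hs ha)).trans (Finset.mem_singleton.1 (hs hb)).symm)
  have hf0 : f.coeff.support.card ≠ 0 := by
    intro h
    rw [Finset.card_eq_zero, Finsupp.support_eq_empty] at h
    have : f = 0 := AddMonoidAlgebra.ext (by simpa using h)
    exact hf.ne_zero this
  have hg0 : g.coeff.support.card ≠ 0 := by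
    intro h
    rw [Finset.card_eq_zero, Finsupp.support_eq_empty] at h
    have : g = 0 := AddMonoidAlgebra.ext (by simpa using h)
    rw [this, mul_zero] at hg
    exact zero_ne_one hg
  have hc : f.coeff.support.card = 1 := by
    have h2 := Nat.mul_le_mul_left f.coeff.support.card (Nat.pos_of_ne_zero hg0)
    simp only [Nat.succ_eq_add_one, zero_add, mul_one] at h2
    omega
  obtain ⟨m, c, hc, h⟩ := Finsupp.card_support_eq_one'.1 hc
  exact ⟨m, c, hc, AddMonoidAlgebra.ext (by rw [h]; rfl)⟩

/-! ### The coordinate rings of the charts -/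

/-- A lattice vector is determined by its pairings with a basis, which are arbitrary. -/
noncomputable def pairingEquiv {n : ℕ} (b : Module.Basis (Fin n) ℤ (Fin n → ℤ)) :
    (Fin n → ℤ) ≃ₗ[ℤ] (Fin n → ℤ) :=
  (dotProductEquiv ℤ (Fin n)).trans (b.constr ℤ).symm

theorem pairingEquiv_apply {n : ℕ} (b : Module.Basis (Fin n) ℤ (Fin n → ℤ)) (m : Fin n → ℤ)
    (i : Fin n) : pairingEquiv b m i = m ⬝ᵥ b i := by
  simp [pairingEquiv, dotProductEquiv]

theorem pairingEquiv_symm_dotProduct {n : ℕ} (b : Module.Basis (Fin n) ℤ (Fin n → ℤ))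
    (c : Fin n → ℤ) (i : Fin n) : (pairingEquiv b).symm c ⬝ᵥ b i = c i := by
  rw [← pairingEquiv_apply, LinearEquiv.apply_symm_apply]

theorem mem_chartRing {k : Type u} [Field k] {n : ℕ} {s : Finset (Fin n → ℤ)}
    {f : TorusRing k n} :
    f ∈ chartRing k s ↔ ∀ m ∈ f.coeff.support, ∀ u ∈ s, 0 ≤ m ⬝ᵥ u := Iff.rfl

/-- The chart of a cone generated by a basis is an affine space. -/
theorem nonempty_mvPolynomial_equiv_chartRing (k : Type u) [Field k] {n : ℕ}
    (b : Module.Basis (Fin n) ℤ (Fin n → ℤ)) :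
    Nonempty (MvPolynomial (Fin n) k ≃ₐ[k] chartRing k (Finset.univ.image b)) := by
  -- A monomial with exponent `c` goes to the character whose pairings with the basis are the
  -- entries of `c`.
  let e : (Fin n →₀ ℕ) →+ (Fin n → ℤ) :=
    { toFun := fun c => (pairingEquiv b).symm fun i => (c i : ℤ)
      map_zero' := by
        rw [LinearEquiv.symm_apply_eq, map_zero]
        ext i
        exact Int.natCast_zero
      map_add' := fun c d => by
        rw [← map_add]
        congr 1 }
  have he : Function.Injective e := by
    intro c d h
    have := (pairingEquiv b).symm.injective h
    ext i
    exact_mod_cast congrFun this i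
  let φ : MvPolynomial (Fin n) k →ₐ[k] TorusRing k n :=
    AddMonoidAlgebra.mapDomainAlgHom k k e
  have hφ : Function.Injective φ := AddMonoidAlgebra.mapDomain_injective he
  have hr : φ.range = chartRing k (Finset.univ.image b) := by
    ext f
    rw [mem_chartRing]
    constructor
    · rintro ⟨p, rfl⟩ m hm
      classical
      obtain ⟨c, -, rfl⟩ := Finset.mem_image.1 (Finsupp.mapDomain_support hm)
      intro u hu
      obtain ⟨i, -, rfl⟩ := Finset.mem_image.1 hu
      change 0 ≤ (pairingEquiv b).symm _ ⬝ᵥ b i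
      rw [pairingEquiv_symm_dotProduct]
      positivity
    · intro hf
      have hf' : ∀ m ∈ f.coeff.support, AddMonoidAlgebra.single m (f.coeff m) ∈ φ.range := by
        intro m hm
        refine ⟨AddMonoidAlgebra.single
          (Finsupp.equivFunOnFinite.symm fun i => (m ⬝ᵥ b i).toNat) (f.coeff m), ?_⟩
        change AddMonoidAlgebra.mapDomain e _ = _
        rw [AddMonoidAlgebra.mapDomain_single]
        congr 1
        change (pairingEquiv b).symm _ = _
        rw [LinearEquiv.symm_apply_eq]
        ext i
        rw [pairingEquiv_apply]
        have := hf m hm (b i) (Finset.mem_image_of_mem _ (Finset.mem_univ i))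
        simpa using this
      have hsum : f = ∑ m ∈ f.coeff.support, AddMonoidAlgebra.single m (f.coeff m) :=
        (AddMonoidAlgebra.sum_coeff_single f).symm
      rw [hsum]
      exact sum_mem hf'
  exact ⟨(AlgEquiv.ofInjective φ hφ).trans (Subalgebra.equivOfEq _ _ hr)⟩

/-- A smooth cone is a face of the cone over a full basis, whose chart is an affine space. Both
properties pass to the localization at a character. -/
theorem chartRing_isNoetherianRing_and_uniqueFactorizationMonoid (k : Type u) [Field k] {n : ℕ}
    {s : Finset (Fin n → ℤ)}
    (hs : ∃ b : Module.Basis (Fin n) ℤ (Fin n → ℤ), (s : Set (Fin n → ℤ)) ⊆ Set.range b) :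
    IsNoetherianRing (chartRing k s) ∧ UniqueFactorizationMonoid (chartRing k s) := by
  classical
  obtain ⟨b, hb⟩ := hs
  obtain ⟨e⟩ := nonempty_mvPolynomial_equiv_chartRing k b
  have hN : IsNoetherianRing (chartRing k (Finset.univ.image b)) :=
    isNoetherianRing_of_ringEquiv _ e.toRingEquiv
  have hU : UniqueFactorizationMonoid (chartRing k (Finset.univ.image b)) :=
    e.toMulEquiv.uniqueFactorizationMonoid inferInstance
  have hst : s ⊆ Finset.univ.image b := fun u hu => by
    obtain ⟨i, rfl⟩ := hb hu
    exact Finset.mem_image_of_mem _ (Finset.mem_univ i)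
  -- The character to invert is orthogonal to `s` and positive on the added basis vectors.
  let m := (pairingEquiv b).symm fun i => if b i ∈ s then 0 else 1
  have hm : ∀ i, m ⬝ᵥ b i = if b i ∈ s then 0 else 1 := pairingEquiv_symm_dotProduct b _
  have hmem : m ∈ dualMonoid (Finset.univ.image b) := fun u hu => by
    obtain ⟨i, -, rfl⟩ := Finset.mem_image.1 hu
    rw [hm]; split_ifs <;> simp
  let := (chartIncl k hst).toAlgebra
  have := chartIncl_isLocalization k hst m hmem
    (fun u hu => by
      obtain ⟨i, rfl⟩ := hb hu
      rw [hm, if_pos hu])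
    (fun u hu hus => by
      obtain ⟨i, -, rfl⟩ := Finset.mem_image.1 hu
      rw [hm, if_neg hus])
  exact ⟨IsLocalization.isNoetherianRing
      (Submonoid.powers (⟨character k m, character_mem hmem⟩ : chartRing k _)) _ hN,
    UniqueFactorizationMonoid.of_isLocalization
      (Submonoid.powers (⟨character k m, character_mem hmem⟩ : chartRing k _)) _⟩

/-! ### Restriction of ideal sheaves to faces -/

namespace SmoothFan

variable {n : ℕ} {F : SmoothFan n} {k : Type u} [Field k]

theorem map_chart {s t : {s // s ∈ F.cones}} (h : t ≤ s) :
    Spec.map (CommRingCat.ofHom (chartIncl k h)) ≫ F.chart k s = F.chart k t :=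
  colimit.w (F.chartDiagram k) (homOfLE h)

/-- Quasi-coherence: the ideal over a smaller affine open is generated by the restriction of the
larger one, and this restriction is `chartIncl` in coordinates. -/
theorem idealOn_face (I : (F.toricVariety k).IdealSheafData) {s t : {s // s ∈ F.cones}}
    (h : t ≤ s) : idealOn I t = (idealOn I s).map (chartIncl k h) := by
  have hle : (F.chart k t).opensRange ≤ (F.chart k s).opensRange := by
    rintro x ⟨y, rfl⟩
    rw [← map_chart h]
    exact ⟨_, (Scheme.Hom.comp_apply _ _ _).symm⟩
  have key : (F.toricVariety k).presheaf.map (homOfLE hle).op ≫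
      ((F.chart k t).appLE (F.chart k t).opensRange ⊤ (by simp) ≫
        (Scheme.ΓSpecIso (CommRingCat.of (chartRing k t.1))).hom) =
      ((F.chart k s).appLE (F.chart k s).opensRange ⊤ (by simp) ≫
        (Scheme.ΓSpecIso (CommRingCat.of (chartRing k s.1))).hom) ≫
        CommRingCat.ofHom (chartIncl k h) := by
    rw [Category.assoc, ← Scheme.ΓSpecIso_naturality, ← Category.assoc, ← Category.assoc,
      Scheme.Hom.map_appLE]
    congr 1
    have happ : (Spec.map (CommRingCat.ofHom (chartIncl k h))).appTop =
        (Spec.map (CommRingCat.ofHom (chartIncl k h))).appLE ⊤ ⊤ (by simp) :=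
      Scheme.Hom.app_eq_appLE _
    rw [happ]
    refine Eq.trans ?_ (Scheme.Hom.appLE_comp_appLE _ _ _ _ _ _ _).symm
    simp only [map_chart h]
  have hI : I.ideal ⟨(F.chart k t).opensRange, isAffineOpen_opensRange (F.chart k t)⟩ = _ :=
    (I.map_ideal (V := ⟨(F.chart k s).opensRange, isAffineOpen_opensRange (F.chart k s)⟩) hle).symm
  have h1 : idealOn I t = Ideal.map _ (I.ideal ⟨_, isAffineOpen_opensRange (F.chart k t)⟩) := rfl
  rw [hI, Ideal.map_map] at h1
  rw [h1, idealOn, Ideal.map_map]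
  exact congrArg (fun f => Ideal.map f _) (congrArg CommRingCat.Hom.hom key)

theorem idealOn_top (s : {s // s ∈ F.cones}) :
    idealOn (⊤ : (F.toricVariety k).IdealSheafData) s = ⊤ := by
  simp [idealOn, Ideal.map_top]

end SmoothFan

/-! ### Characters and local data -/

theorem character_ne_zero {k : Type u} [Field k] {n : ℕ} (m : Fin n → ℤ) :
    character k m ≠ 0 := by
  intro h
  have := congrArg (fun f => f.coeff m) h
  simp [character] at this

theorem character_zero {k : Type u} [Field k] {n : ℕ} :
    character k (0 : Fin n → ℤ) = 1 := rfl

theorem coeff_character_mul {k : Type u} [Field k] {n : ℕ} (m p : Fin n → ℤ) (f : TorusRing k n) :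
    (character k m * f).coeff p = f.coeff (p - m) := by
  have := AddMonoidAlgebra.coeff_single_mul_add (r := (1 : k)) f m (p - m)
  simpa [character] using this

theorem mem_support_character_mul {k : Type u} [Field k] {n : ℕ} {m p : Fin n → ℤ}
    {f : TorusRing k n} :
    p ∈ (character k m * f).coeff.support ↔ p - m ∈ f.coeff.support := by
  rw [Finsupp.mem_support_iff, Finsupp.mem_support_iff, coeff_character_mul]

theorem mem_dualMonoid_of_character_mem {k : Type u} [Field k] {n : ℕ}
    {s : Finset (Fin n → ℤ)} {m : Fin n → ℤ} (h : character k m ∈ chartRing k s) :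
    m ∈ dualMonoid s :=
  h m (by simp [character])

theorem chartRing_smul_def {k : Type u} [Field k] {n : ℕ} {s : Finset (Fin n → ℤ)}
    (c : chartRing k s) (x : TorusField k n) :
    c • x = algebraMap (TorusRing k n) (TorusField k n) (c : TorusRing k n) * x :=
  Algebra.smul_def c x

/-- On a smooth cone every invariant divisor is Cartier; `m` is its local datum. -/
theorem exists_dotProduct_eq_of_subset_range_basis {n : ℕ} {s : Finset (Fin n → ℤ)}
    (hs : ∃ b : Module.Basis (Fin n) ℤ (Fin n → ℤ), (s : Set (Fin n → ℤ)) ⊆ Set.range b)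
    (a : (Fin n → ℤ) → ℤ) : ∃ m : Fin n → ℤ, ∀ u ∈ s, m ⬝ᵥ u = a u := by
  obtain ⟨b, hb⟩ := hs
  refine ⟨(pairingEquiv b).symm fun i => a (b i), fun u hu => ?_⟩
  obtain ⟨i, rfl⟩ := hb hu
  exact pairingEquiv_symm_dotProduct b _ i

/-- In a domain an associated prime of R/0 consists of zero divisors, so it is zero and cannot have
height one. -/
theorem Ideal.ne_bot_of_forall_height_associatedPrimes_eq_one {R : Type*} [CommRing R]
    [IsDomain R] [IsNoetherianRing R] (I : Ideal R)
    (hI : ∀ P ∈ associatedPrimes R (R ⧸ I), P.height = 1) : I ≠ ⊥ := by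
  rintro rfl
  have : Nontrivial (R ⧸ (⊥ : Ideal R)) := Ideal.Quotient.nontrivial_iff.2 bot_ne_top
  obtain ⟨P, hP⟩ := associatedPrimes.nonempty R (R ⧸ (⊥ : Ideal R))
  refine Ideal.ne_bot_of_height_eq_one (hI P hP) ?_
  rw [eq_bot_iff]
  intro p hp
  have h1 : p ∈ ⋃ P ∈ associatedPrimes R (R ⧸ (⊥ : Ideal R)), (P : Set R) :=
    Set.mem_biUnion hP hp
  rw [biUnion_associatedPrimes_eq_zero_divisors] at h1
  obtain ⟨x, hx, hpx⟩ := h1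
  obtain ⟨x, rfl⟩ := Ideal.Quotient.mk_surjective x
  have h2 : (Ideal.Quotient.mk (⊥ : Ideal R)) (p * x) = 0 := hpx
  rw [Ideal.Quotient.eq_zero_iff_mem, Ideal.mem_bot, mul_eq_zero] at h2
  refine h2.resolve_right fun h => hx ?_
  rw [h, map_zero]

/-! ### Hypersurfaces and invariant divisors -/

namespace SmoothFan

variable {n : ℕ} {F : SmoothFan n} {k : Type u} [Field k]

theorem IsComplete.empty_mem (hF : F.IsComplete) : ∅ ∈ F.cones := by
  obtain ⟨s, hs, -⟩ := hF 0
  exact F.face_mem s hs ∅ (Finset.empty_subset s)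

/-- Up to characters, a hypersurface has the same equation on all charts. -/
theorem IsHypersurface.exists_equation (hF : F.IsComplete) {I : (F.toricVariety k).IdealSheafData}
    (hI : IsHypersurface I) : ∃ f : TorusRing k n, f ≠ 0 ∧ ∀ s : {s // s ∈ F.cones},
      ∃ (m : Fin n → ℤ) (h : character k m * f ∈ chartRing k s.1),
        idealOn I s = Ideal.span {⟨character k m * f, h⟩} := by
  have hprin : ∀ s : {s // s ∈ F.cones}, ∃ f : chartRing k s.1, idealOn I s = Ideal.span {f} := by
    intro s
    obtain ⟨_, _⟩ := chartRing_isNoetherianRing_and_uniqueFactorizationMonoid k (F.smooth s.1 s.2)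
    obtain ⟨f, hf⟩ := Ideal.isPrincipal_of_forall_height_associatedPrimes_eq_one _ (hI s)
    exact ⟨f, hf⟩
  -- The empty cone gives the torus, which lies in every chart; its equation is the reference for
  -- all others.
  let o : {s // s ∈ F.cones} := ⟨∅, hF.empty_mem⟩
  obtain ⟨f, hf⟩ := hprin o
  have hf0 : f ≠ 0 := by
    rintro rfl
    obtain ⟨_, _⟩ := chartRing_isNoetherianRing_and_uniqueFactorizationMonoid k (F.smooth o.1 o.2)
    refine Ideal.ne_bot_of_forall_height_associatedPrimes_eq_one _ (hI o) ?_
    rw [hf, Ideal.span_singleton_eq_bot]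
  refine ⟨f, fun h => hf0 (Subtype.ext h), fun s => ?_⟩
  obtain ⟨g, hg⟩ := hprin s
  have hos : o ≤ s := Finset.empty_subset s.1
  have h1 := idealOn_face I hos
  rw [hf, hg, Ideal.map_span, Set.image_singleton, Ideal.span_singleton_eq_span_singleton] at h1
  obtain ⟨v, hv⟩ := h1
  have hv' : (f : TorusRing k n) * ((v : chartRing k o.1) : TorusRing k n) = g :=
    congrArg (fun z : chartRing k o.1 => (z : TorusRing k n)) hv
  -- The unit relating the two generators is a monomial; its scalar is a unit on every chart and can
  -- be dropped.
  obtain ⟨m, c, hc, hm⟩ := torusRing_isUnit (v.isUnit.map (chartRing k o.1).val)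
  have hm : ((v : chartRing k o.1) : TorusRing k n) = AddMonoidAlgebra.single m c := hm
  have hcm : AddMonoidAlgebra.single m c = algebraMap k (TorusRing k n) c * character k m := by
    simp [character, AddMonoidAlgebra.single_mul_single]
  have hg' : (g : TorusRing k n) =
      algebraMap k (TorusRing k n) c * (character k m * (f : TorusRing k n)) := by
    rw [← hv', hm, hcm]; ring
  have hmem : character k m * (f : TorusRing k n) ∈ chartRing k s.1 := by
    have h2 : character k m * (f : TorusRing k n) = algebraMap k (TorusRing k n) c⁻¹ * g := by
      rw [hg', ← mul_assoc, ← map_mul, inv_mul_cancel₀ hc, map_one, one_mul]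
    rw [h2]
    exact mul_mem (algebraMap_mem _ _) g.2
  refine ⟨m, hmem, ?_⟩
  rw [hg, Ideal.span_singleton_eq_span_singleton]
  refine Associated.symm
    ⟨Units.map (algebraMap k (chartRing k s.1)).toMonoidHom (Units.mk0 c hc), ?_⟩
  apply Subtype.ext
  change character k m * (f : TorusRing k n) * algebraMap k (TorusRing k n) c = g
  rw [hg', mul_comm]

theorem invariantIdeal_eq_span {a : (Fin n → ℤ) → ℤ} {s : {s // s ∈ F.cones}} {m : Fin n → ℤ}
    (hm : ∀ u ∈ s.1, m ⬝ᵥ u = a u) : invariantIdeal k a s = Submodule.span (chartRing k s.1)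
      {algebraMap (TorusRing k n) (TorusField k n) (character k m)} := by
  apply le_antisymm
  · refine Submodule.span_le.2 ?_
    rintro _ ⟨p, hp, rfl⟩
    refine Submodule.mem_span_singleton.2 ⟨⟨character k (p - m), character_mem fun u hu => ?_⟩, ?_⟩
    · rw [sub_dotProduct, hm u hu]
      linarith [hp u hu]
    · rw [chartRing_smul_def, ← map_mul, character_mul, sub_add_cancel]
  · refine Submodule.span_mono ?_
    rintro _ rfl
    exact ⟨m, fun u hu => (hm u hu).ge, rfl⟩

/-- The coefficient along a ray is the pairing of its generator with the exponent of a local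
equation. It does not depend on the cone: on the chart of the ray two local equations generate the
same ideal, so their quotient, a character, is regular there together with its inverse. -/
theorem IsHypersurface.exists_isLinearlyEquivalent (hF : F.IsComplete)
    {I : (F.toricVariety k).IdealSheafData} (hI : IsHypersurface I) :
    ∃ a : (Fin n → ℤ) → ℤ, IsLinearlyEquivalent I a := by
  classical
  obtain ⟨f, hf0, hf⟩ := hI.exists_equation hF
  choose m hmem hm using hf
  have key : ∀ s t : {s // s ∈ F.cones}, ∀ u, ∀ hr : {u} ∈ F.cones, u ∈ s.1 → u ∈ t.1 →
      m s ⬝ᵥ u ≤ m t ⬝ᵥ u := by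
    intro s t u hr hs ht
    let r : {s // s ∈ F.cones} := ⟨{u}, hr⟩
    have h1 := idealOn_face I (show r ≤ s from Finset.singleton_subset_iff.2 hs)
    have h2 := idealOn_face I (show r ≤ t from Finset.singleton_subset_iff.2 ht)
    rw [h1, hm s, hm t, Ideal.map_span, Ideal.map_span, Set.image_singleton, Set.image_singleton,
      Ideal.span_singleton_eq_span_singleton] at h2
    obtain ⟨w, hw⟩ := h2.dvd
    have hw' : character k (m t) * f = character k (m s) * f * (w : TorusRing k n) :=
      congrArg (fun z : chartRing k r.1 => (z : TorusRing k n)) hw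
    have hw2 : (w : TorusRing k n) = character k (m t - m s) := by
      apply mul_left_cancel₀ (mul_ne_zero (character_ne_zero (m s)) hf0)
      rw [← hw', mul_right_comm, character_mul, add_sub_cancel]
    have hw3 := w.2
    rw [hw2] at hw3
    have := mem_dualMonoid_of_character_mem hw3 u (Finset.mem_singleton_self u)
    rw [sub_dotProduct] at this
    linarith
  -- The value off the rays is immaterial, since every generator of a cone spans a ray of the fan.
  let a : (Fin n → ℤ) → ℤ := fun u => if h : {u} ∈ F.cones then m ⟨{u}, h⟩ ⬝ᵥ u else 0
  have hfK : algebraMap (TorusRing k n) (TorusField k n) f ≠ 0 := by simpa using hf0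
  refine ⟨a, Units.mk0 _ hfK, fun s => ?_⟩
  have ha : ∀ u ∈ s.1, m s ⬝ᵥ u = a u := by
    intro u hu
    have h : {u} ∈ F.cones := F.face_mem s.1 s.2 _ (Finset.singleton_subset_iff.2 hu)
    simp only [a, dif_pos h]
    exact le_antisymm (key _ _ u h hu (Finset.mem_singleton_self u))
      (key _ _ u h (Finset.mem_singleton_self u) hu)
  rw [invariantIdeal_eq_span ha, Submodule.span_mul_span, Set.singleton_mul_singleton, hm s,
    IsLocalization.coeSubmodule_span_singleton]
  congr 2
  change algebraMap (TorusRing k n) (TorusField k n) (character k (m s) * f) = _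
  rw [map_mul, mul_comm]
  rfl

end SmoothFan

/-! ### Sections given by supports of Laurent polynomials -/

/-- The multiples by `c` of the Laurent polynomials with support in `S`. -/
def laurentSections {k : Type u} [Field k] {n : ℕ} (c : TorusField k n) (S : Set (Fin n → ℤ)) :
    Submodule k (TorusField k n) where
  carrier := {x | ∃ h : TorusRing k n, (∀ m ∈ h.coeff.support, m ∈ S) ∧
    x = c * algebraMap (TorusRing k n) (TorusField k n) h}
  zero_mem' := ⟨0, by simp, by simp⟩
  add_mem' := by
    classical
    rintro _ _ ⟨h, hh, rfl⟩ ⟨h', hh', rfl⟩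
    refine ⟨h + h', fun m hm => ?_, by rw [map_add, mul_add]⟩
    rcases Finset.mem_union.1 (Finsupp.support_add hm) with h | h
    · exact hh m h
    · exact hh' m h
  smul_mem' := by
    rintro r _ ⟨h, hh, rfl⟩
    refine ⟨r • h, fun m hm => hh m (Finsupp.support_smul hm), ?_⟩
    rw [Algebra.smul_def r h, Algebra.smul_def, map_mul, ← IsScalarTower.algebraMap_apply]
    ring

theorem mem_laurentSections {k : Type u} [Field k] {n : ℕ} {c x : TorusField k n}
    {S : Set (Fin n → ℤ)} : x ∈ laurentSections c S ↔ ∃ h : TorusRing k n,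
      (∀ m ∈ h.coeff.support, m ∈ S) ∧ x = c * algebraMap (TorusRing k n) (TorusField k n) h :=
  Iff.rfl

theorem mul_algebraMap_mem_laurentSections {k : Type u} [Field k] {n : ℕ} {c : TorusField k n}
    (hc : c ≠ 0) {h : TorusRing k n} {S : Set (Fin n → ℤ)} :
    c * algebraMap (TorusRing k n) (TorusField k n) h ∈ laurentSections c S ↔
      ∀ m ∈ h.coeff.support, m ∈ S := by
  refine ⟨?_, fun H => ⟨h, H, rfl⟩⟩
  rintro ⟨h', hh', he⟩
  have := IsFractionRing.injective (TorusRing k n) (TorusField k n) (mul_left_cancel₀ hc he)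
  rwa [this]

namespace SmoothFan

variable {n : ℕ} {F : SmoothFan n} {k : Type u} [Field k]

/-- The ideal of `H` on the chart is generated by g χ^m, and the colon module of a principal
fractional ideal is generated by the inverse. -/
theorem sheafO_eq_span {I : (F.toricVariety k).IdealSheafData} {a : (Fin n → ℤ) → ℤ}
    {g : (TorusField k n)ˣ} {s : {s // s ∈ F.cones}}
    (hg : IsLocalization.coeSubmodule (TorusField k n) (idealOn I s) =
      Submodule.span (chartRing k s.1) {(g : TorusField k n)} * invariantIdeal k a s) (d : ℕ)
    {m : Fin n → ℤ} (hm : ∀ u ∈ s.1, m ⬝ᵥ u = a u) :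
    sheafO I d s = Submodule.span (chartRing k s.1) {((g : TorusField k n)⁻¹) ^ d *
      algebraMap (TorusRing k n) (TorusField k n) (character k (-((d : ℤ) • m)))} := by
  set ι := algebraMap (TorusRing k n) (TorusField k n)
  have hx : (g : TorusField k n) ^ d * ι (character k m) ^ d *
      ((g : TorusField k n)⁻¹ ^ d * ι (character k (-((d : ℤ) • m)))) = 1 := by
    have h1 : ι (character k m) ^ d * ι (character k (-((d : ℤ) • m))) = 1 := by
      rw [← map_pow, ← map_mul, character_pow, character_mul]
      simp [character_zero]
    have h2 : (g : TorusField k n) ^ d * (g : TorusField k n)⁻¹ ^ d = 1 := by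
      rw [← mul_pow, mul_inv_cancel₀ g.ne_zero, one_pow]
    rw [mul_mul_mul_comm, h1, h2, mul_one]
  rw [sheafO, hg, invariantIdeal_eq_span hm, Submodule.span_mul_span,
    Set.singleton_mul_singleton, Submodule.span_pow, Set.singleton_pow, mul_pow]
  ext x
  rw [Submodule.mem_div_iff_forall_mul_mem, Submodule.mem_span_singleton]
  constructor
  · intro h
    obtain ⟨c, hc⟩ := Submodule.mem_one.1 (h _ (Submodule.mem_span_singleton_self _))
    refine ⟨c, ?_⟩
    rw [Algebra.smul_def, hc, mul_assoc, hx, mul_one]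
  · rintro ⟨c, rfl⟩ y hy
    obtain ⟨e, rfl⟩ := Submodule.mem_span_singleton.1 hy
    refine Submodule.mem_one.2 ⟨c * e, ?_⟩
    rw [Algebra.smul_def c, Algebra.smul_def e, map_mul, mul_mul_mul_comm, mul_comm (_ * ι _),
      hx, mul_one]

/-- Multiplication by χ^{dm} turns the inequalities on exponents into membership in the dual monoid.
-/
theorem mem_sheafO_iff {I : (F.toricVariety k).IdealSheafData} {a : (Fin n → ℤ) → ℤ}
    {g : (TorusField k n)ˣ} {s : {s // s ∈ F.cones}}
    (hg : IsLocalization.coeSubmodule (TorusField k n) (idealOn I s) =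
      Submodule.span (chartRing k s.1) {(g : TorusField k n)} * invariantIdeal k a s) (d : ℕ)
    (x : TorusField k n) : x ∈ sheafO I d s ↔
      x ∈ laurentSections ((g : TorusField k n)⁻¹ ^ d) {m | ∀ u ∈ s.1, -(d * a u) ≤ m ⬝ᵥ u} := by
  obtain ⟨m, hm⟩ := exists_dotProduct_eq_of_subset_range_basis (F.smooth s.1 s.2) a
  rw [sheafO_eq_span hg d hm, Submodule.mem_span_singleton, mem_laurentSections]
  constructor
  · rintro ⟨c, rfl⟩
    refine ⟨character k (-((d : ℤ) • m)) * c, fun p hp u hu => ?_, ?_⟩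
    · have := c.2 _ (mem_support_character_mul.1 hp) u hu
      rw [sub_neg_eq_add, add_dotProduct, smul_dotProduct, hm u hu, smul_eq_mul] at this
      linarith
    · rw [map_mul, chartRing_smul_def]
      ring
  · rintro ⟨h, hh, rfl⟩
    refine ⟨⟨character k ((d : ℤ) • m) * h, fun p hp u hu => ?_⟩, ?_⟩
    · have := hh _ (mem_support_character_mul.1 hp) u hu
      rw [sub_dotProduct, smul_dotProduct, hm u hu, smul_eq_mul] at this
      linarith
    · rw [chartRing_smul_def, mul_left_comm, ← map_mul, mul_right_comm, character_mul,
        add_neg_cancel, character_zero, one_mul]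

/-- The ideal is monomial. The condition on exponents survives multiplication because pairings with
`τ` are nonnegative on the chart, so a sum vanishes only if both terms do. -/
theorem mem_orbitClosureIdeal_iff {τ s : {s // s ∈ F.cones}} (hτ : τ.1 ⊆ s.1)
    (c : chartRing k s.1) : c ∈ orbitClosureIdeal k τ s ↔
      ∀ m ∈ (c : TorusRing k n).coeff.support, ∃ u ∈ τ.1, m ⬝ᵥ u ≠ 0 := by
  classical
  constructor
  · intro hc
    induction hc using Submodule.span_induction with
    | mem x hx =>
      obtain ⟨m, -, hu, hm⟩ := hx
      intro p hp
      rw [hm] at hp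
      have hp' : p ∈ (Finsupp.single m (1 : k)).support := hp
      rwa [Finset.mem_singleton.1 (Finsupp.support_single_subset hp')]
    | zero => simp
    | add x y _ _ hx hy =>
      intro m hm
      rcases Finset.mem_union.1 (Finsupp.support_add hm) with h | h
      · exact hx m h
      · exact hy m h
    | smul r x _ hx =>
      intro m hm
      obtain ⟨p, hp, q, hq, rfl⟩ :=
        Finset.mem_add.1 (AddMonoidAlgebra.support_coeff_mul_subset _ _ hm)
      obtain ⟨u, hu, hne⟩ := hx q hq
      refine ⟨u, hu, ?_⟩
      have h1 := r.2 p hp u (hτ hu)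
      have h2 := x.2 q hq u (hτ hu)
      rw [add_dotProduct]
      omega
  · intro h
    have hc : c = ∑ m ∈ (c : TorusRing k n).coeff.support.attach,
        algebraMap k (chartRing k s.1) ((c : TorusRing k n).coeff m) *
          ⟨character k m.1, character_mem (c.2 m.1 m.2)⟩ := by
      apply Subtype.ext
      rw [AddSubmonoidClass.coe_finsetSum]
      change _ = ∑ m ∈ (c : TorusRing k n).coeff.support.attach,
        algebraMap k (TorusRing k n) ((c : TorusRing k n).coeff m) * character k m.1
      rw [Finset.sum_attach (c : TorusRing k n).coeff.support fun m =>
        algebraMap k (TorusRing k n) ((c : TorusRing k n).coeff m) * character k m]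
      nth_rewrite 1 [← AddMonoidAlgebra.sum_coeff_single (c : TorusRing k n)]
      refine Finset.sum_congr rfl fun m _ => ?_
      simp [character, AddMonoidAlgebra.single_mul_single]
    rw [hc]
    exact sum_mem fun m _ => Ideal.mul_mem_left _ _
      (Ideal.subset_span ⟨m.1, c.2 m.1 m.2, h m.1 m.2, rfl⟩)

theorem sectionsO_eq {I : (F.toricVariety k).IdealSheafData} {a : (Fin n → ℤ) → ℤ}
    {g : (TorusField k n)ˣ} {s : {s // s ∈ F.cones}}
    (hg : IsLocalization.coeSubmodule (TorusField k n) (idealOn I s) =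
      Submodule.span (chartRing k s.1) {(g : TorusField k n)} * invariantIdeal k a s) (d : ℕ) :
    sectionsO I d s =
      laurentSections ((g : TorusField k n)⁻¹ ^ d) {m | ∀ u ∈ s.1, -(d * a u) ≤ m ⬝ᵥ u} := by
  ext x
  exact mem_sheafO_iff hg d x

/-- A monomial section is nonzero on the orbit closure exactly when its inequalities along `τ` are
all equalities. -/
theorem vanishingO_eq {I : (F.toricVariety k).IdealSheafData} {a : (Fin n → ℤ) → ℤ}
    {g : (TorusField k n)ˣ} {τ s : {s // s ∈ F.cones}}
    (hg : IsLocalization.coeSubmodule (TorusField k n) (idealOn I s) =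
      Submodule.span (chartRing k s.1) {(g : TorusField k n)} * invariantIdeal k a s)
    (hτ : τ.1 ⊆ s.1) (d : ℕ) :
    vanishingO I d τ s = laurentSections ((g : TorusField k n)⁻¹ ^ d)
      {m | (∀ u ∈ s.1, -(d * a u) ≤ m ⬝ᵥ u) ∧ ∃ u ∈ τ.1, m ⬝ᵥ u ≠ -(d * a u)} := by
  obtain ⟨m, hm⟩ := exists_dotProduct_eq_of_subset_range_basis (F.smooth s.1 s.2) a
  ext x
  change x ∈ IsLocalization.coeSubmodule (TorusField k n) (orbitClosureIdeal k τ s) *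
    sheafO I d s ↔ _
  rw [sheafO_eq_span hg d hm, Submodule.mul_comm, Submodule.mem_span_singleton_mul,
    mem_laurentSections]
  constructor
  · rintro ⟨_, ⟨c, hc, rfl⟩, rfl⟩
    rw [SetLike.mem_coe, mem_orbitClosureIdeal_iff hτ] at hc
    refine ⟨character k (-((d : ℤ) • m)) * c, fun p hp => ⟨fun u hu => ?_, ?_⟩, ?_⟩
    · have := c.2 _ (mem_support_character_mul.1 hp) u hu
      rw [sub_neg_eq_add, add_dotProduct, smul_dotProduct, hm u hu, smul_eq_mul] at this
      linarith
    · obtain ⟨u, hu, hne⟩ := hc _ (mem_support_character_mul.1 hp)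
      refine ⟨u, hu, fun h => hne ?_⟩
      rw [sub_neg_eq_add, add_dotProduct, smul_dotProduct, hm u (hτ hu), smul_eq_mul, h]
      ring
    · rw [map_mul, mul_assoc]
      rfl
  · rintro ⟨h, hh, rfl⟩
    refine ⟨_, ⟨⟨character k ((d : ℤ) • m) * h, fun p hp u hu => ?_⟩, ?_, rfl⟩, ?_⟩
    · have := (hh _ (mem_support_character_mul.1 hp)).1 u hu
      rw [sub_dotProduct, smul_dotProduct, hm u hu, smul_eq_mul] at this
      linarith
    · rw [SetLike.mem_coe, mem_orbitClosureIdeal_iff hτ]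
      intro p hp
      obtain ⟨u, hu, hne⟩ := (hh _ (mem_support_character_mul.1 hp)).2
      refine ⟨u, hu, fun h => hne ?_⟩
      rw [sub_dotProduct, smul_dotProduct, hm u (hτ hu), smul_eq_mul, h]
      ring
    · change _ * algebraMap (TorusRing k n) (TorusField k n) (character k ((d : ℤ) • m) * h) = _
      rw [mul_assoc, ← map_mul, ← mul_assoc, character_mul, neg_add_cancel, character_zero,
        one_mul]

end SmoothFan

/-! ### Coordinates on smooth cones -/

theorem latticeVec_dotProduct {n : ℕ} (a b : Fin n → ℤ) :
    latticeVec a ⬝ᵥ latticeVec b = ((a ⬝ᵥ b : ℤ) : ℝ) := by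
  simp [latticeVec, dotProduct]

theorem latticeVec_sub {n : ℕ} (a b : Fin n → ℤ) :
    latticeVec (a - b) = latticeVec a - latticeVec b := by
  ext i; simp [latticeVec]

theorem latticeVec_smul {n : ℕ} (c : ℤ) (a : Fin n → ℤ) :
    latticeVec (c • a) = (c : ℝ) • latticeVec a := by
  ext i; simp [latticeVec]

/-- The dual basis of a basis of the lattice. -/
noncomputable def dualVec {n : ℕ} (b : Module.Basis (Fin n) ℤ (Fin n → ℤ)) (i : Fin n) :
    Fin n → ℤ :=
  (pairingEquiv b).symm (Pi.single i 1)

theorem dualVec_dotProduct {n : ℕ} (b : Module.Basis (Fin n) ℤ (Fin n → ℤ)) (i j : Fin n) :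
    dualVec b i ⬝ᵥ b j = if j = i then 1 else 0 := by
  rw [dualVec, pairingEquiv_symm_dotProduct, Pi.single_apply]

theorem eq_of_forall_dotProduct_basis_eq {n : ℕ} (b : Module.Basis (Fin n) ℤ (Fin n → ℤ))
    {p q : Fin n → ℤ} (h : ∀ i, p ⬝ᵥ b i = q ⬝ᵥ b i) : p = q :=
  (pairingEquiv b).injective (funext fun i => by rw [pairingEquiv_apply, pairingEquiv_apply, h])

/-- The expansion is the one in the lattice basis for integral vectors, and both sides are linear
over the reals. -/
theorem sum_dualVec_dotProduct_smul {n : ℕ} (b : Module.Basis (Fin n) ℤ (Fin n → ℤ))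
    (x : Fin n → ℝ) : ∑ i, (latticeVec (dualVec b i) ⬝ᵥ x) • latticeVec (b i) = x := by
  have hlattice : ∀ m : Fin n → ℤ, ∑ i, (dualVec b i ⬝ᵥ m) • b i = m := by
    intro m
    have h : ∀ i, dualVec b i ⬝ᵥ m = b.repr m i := fun i => by
      conv_lhs => rw [← b.sum_repr m]
      simp only [dotProduct_sum, dotProduct_smul, dualVec_dotProduct]
      simp
    simp only [h, b.sum_repr]
  let φ : (Fin n → ℝ) →ₗ[ℝ] (Fin n → ℝ) :=
    ∑ i, (dotProductEquiv ℝ (Fin n) (latticeVec (dualVec b i))).smulRight (latticeVec (b i))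
  have hφ : φ = LinearMap.id := by
    refine LinearMap.pi_ext' fun j => LinearMap.ext_ring ?_
    have h2 : latticeVec (Pi.single j 1) = Pi.single j (1 : ℝ) := by
      ext i
      simp only [latticeVec, Pi.single_apply]
      split_ifs <;> simp
    have h1 : ∑ i, (latticeVec (dualVec b i) ⬝ᵥ latticeVec (Pi.single j 1)) • latticeVec (b i) =
        latticeVec (Pi.single j 1) := by
      conv_rhs => rw [← hlattice (Pi.single j 1)]
      ext l
      simp [latticeVec_dotProduct, latticeVec, Finset.sum_apply]
    rw [h2] at h1
    simpa [φ] using h1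
  have := LinearMap.congr_fun hφ x
  simpa [φ] using this

theorem realCone_subset_span {n : ℕ} (s : Finset (Fin n → ℤ)) {x : Fin n → ℝ}
    (hx : x ∈ realCone s) :
    x ∈ Submodule.span ℝ (latticeVec '' (s : Set (Fin n → ℤ))) :=
  Submodule.span_subset_span {c : ℝ // 0 ≤ c} ℝ _ hx

theorem latticeVec_mem_realCone {n : ℕ} {s : Finset (Fin n → ℤ)} {u : Fin n → ℤ} (hu : u ∈ s) :
    latticeVec u ∈ realCone s :=
  Submodule.subset_span ⟨u, hu, rfl⟩

theorem mem_realCone_iff {n : ℕ} {s : Finset (Fin n → ℤ)}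
    {b : Module.Basis (Fin n) ℤ (Fin n → ℤ)} (hs : (s : Set (Fin n → ℤ)) ⊆ Set.range b)
    (x : Fin n → ℝ) : x ∈ realCone s ↔
      (∀ i, 0 ≤ latticeVec (dualVec b i) ⬝ᵥ x) ∧
        ∀ i, b i ∉ s → latticeVec (dualVec b i) ⬝ᵥ x = 0 := by
  classical
  constructor
  · intro hx
    induction hx using Submodule.span_induction with
    | mem x hx =>
      obtain ⟨u, hu, rfl⟩ := hx
      obtain ⟨j, rfl⟩ := hs hu
      refine ⟨fun i => ?_, fun i hi => ?_⟩
      · rw [latticeVec_dotProduct, dualVec_dotProduct]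
        split_ifs <;> simp
      · rw [latticeVec_dotProduct, dualVec_dotProduct, if_neg, Int.cast_zero]
        rintro rfl
        exact hi hu
    | zero => simp
    | add x y _ _ hx hy =>
      refine ⟨fun i => ?_, fun i hi => ?_⟩
      · rw [dotProduct_add]
        exact add_nonneg (hx.1 i) (hy.1 i)
      · rw [dotProduct_add, hx.2 i hi, hy.2 i hi, add_zero]
    | smul r x _ hx =>
      have hr : r • x = (r : ℝ) • x := rfl
      refine ⟨fun i => ?_, fun i hi => ?_⟩
      · rw [hr, dotProduct_smul]
        exact mul_nonneg r.2 (hx.1 i)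
      · rw [hr, dotProduct_smul, hx.2 i hi, smul_zero]
  · rintro ⟨h1, h2⟩
    rw [← sum_dualVec_dotProduct_smul b x]
    refine sum_mem fun i _ => ?_
    by_cases hi : b i ∈ s
    · exact (realCone s).smul_mem (h1 i) (latticeVec_mem_realCone hi)
    · rw [h2 i hi, zero_smul]
      exact zero_mem _

theorem isClosed_realCone {n : ℕ} {s : Finset (Fin n → ℤ)}
    (hs : ∃ b : Module.Basis (Fin n) ℤ (Fin n → ℤ), (s : Set (Fin n → ℤ)) ⊆ Set.range b) :
    IsClosed (realCone s : Set (Fin n → ℝ)) := by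
  obtain ⟨b, hb⟩ := hs
  have : (realCone s : Set (Fin n → ℝ)) = (⋂ i, {x | 0 ≤ latticeVec (dualVec b i) ⬝ᵥ x}) ∩
      ⋂ i, ⋂ (_ : b i ∉ s), {x | latticeVec (dualVec b i) ⬝ᵥ x = 0} := by
    ext x
    simpa using mem_realCone_iff hb x
  rw [this]
  refine IsClosed.inter (isClosed_iInter fun i => isClosed_le continuous_const ?_)
    (isClosed_iInter fun i => isClosed_iInter fun _ => isClosed_eq ?_ continuous_const)
  all_goals exact Continuous.dotProduct continuous_const continuous_id

theorem exists_basis_of_card_eq {n : ℕ} {s : Finset (Fin n → ℤ)}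
    (hs : ∃ b : Module.Basis (Fin n) ℤ (Fin n → ℤ), (s : Set (Fin n → ℤ)) ⊆ Set.range b)
    (hn : s.card = n) : ∃ b : Module.Basis (Fin n) ℤ (Fin n → ℤ),
      (∀ i, b i ∈ s) ∧ ∀ u ∈ s, ∃ i, b i = u := by
  classical
  obtain ⟨b, hb⟩ := hs
  have hsub : s ⊆ Finset.univ.image b := fun u hu => by
    obtain ⟨i, rfl⟩ := hb hu
    exact Finset.mem_image_of_mem _ (Finset.mem_univ i)
  have heq : s = Finset.univ.image b := Finset.eq_of_subset_of_card_le hsub (by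
    rw [hn]
    exact Finset.card_image_le.trans (by simp))
  refine ⟨b, fun i => ?_, fun u hu => hb hu⟩
  rw [heq]
  exact Finset.mem_image_of_mem _ (Finset.mem_univ i)

theorem mem_realCone_iff_of_basis {n : ℕ} {s : Finset (Fin n → ℤ)}
    {b : Module.Basis (Fin n) ℤ (Fin n → ℤ)} (hs : ∀ u ∈ s, ∃ i, b i = u) (hb : ∀ i, b i ∈ s)
    (x : Fin n → ℝ) :
    x ∈ realCone s ↔ ∀ i, 0 ≤ latticeVec (dualVec b i) ⬝ᵥ x := by
  rw [mem_realCone_iff (b := b) hs]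
  exact and_iff_left fun i hi => absurd (hb i) hi

theorem eq_of_forall_dotProduct_eq {n : ℕ} {s : Finset (Fin n → ℤ)}
    (hs : ∃ b : Module.Basis (Fin n) ℤ (Fin n → ℤ), (s : Set (Fin n → ℤ)) ⊆ Set.range b)
    (hn : s.card = n) {p q : Fin n → ℤ} (h : ∀ u ∈ s, p ⬝ᵥ u = q ⬝ᵥ u) : p = q := by
  obtain ⟨b, hb, -⟩ := exists_basis_of_card_eq hs hn
  exact eq_of_forall_dotProduct_basis_eq b fun i => h _ (hb i)

theorem linearMap_eq_of_eqOn_realCone {n : ℕ} {s : Finset (Fin n → ℤ)}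
    (hs : ∃ b : Module.Basis (Fin n) ℤ (Fin n → ℤ), (s : Set (Fin n → ℤ)) ⊆ Set.range b)
    (hn : s.card = n) {l l' : (Fin n → ℝ) →ₗ[ℝ] ℝ} (h : ∀ x ∈ realCone s, l x = l' x) :
    l = l' := by
  obtain ⟨b, hb, -⟩ := exists_basis_of_card_eq hs hn
  refine LinearMap.ext fun x => ?_
  rw [← sum_dualVec_dotProduct_smul b x, map_sum, map_sum]
  refine Finset.sum_congr rfl fun i _ => ?_
  rw [map_smul, map_smul, h _ (latticeVec_mem_realCone (hb i))]

/-! ### Finite unions of proper subspaces -/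

/-- Proper subspaces are Lebesgue null, while a nonempty open set has positive measure. -/
theorem exists_mem_forall_notMem_of_isOpen {n : ℕ} {ι : Type*} (T : Finset ι)
    (W : ι → Submodule ℝ (Fin n → ℝ)) (hW : ∀ i ∈ T, W i ≠ ⊤) {U : Set (Fin n → ℝ)}
    (hU : IsOpen U) (hne : U.Nonempty) : ∃ x ∈ U, ∀ i ∈ T, x ∉ W i := by
  by_contra! h
  have h0 : MeasureTheory.volume (⋃ i ∈ T, (W i : Set (Fin n → ℝ))) = 0 := by
    refine (MeasureTheory.measure_biUnion_null_iff T.countable_toSet).2 ?_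
    exact fun i hi => MeasureTheory.Measure.addHaar_submodule _ _ (hW i hi)
  have h1 : U ⊆ ⋃ i ∈ T, (W i : Set (Fin n → ℝ)) := fun x hx => by
    obtain ⟨i, hi, hxi⟩ := h x hx
    exact Set.mem_biUnion hi hxi
  exact (hU.measure_pos MeasureTheory.volume hne).ne' (MeasureTheory.measure_mono_null h1 h0)

theorem span_ne_top_of_card_lt {n : ℕ} (T : Finset (Fin n → ℝ)) (hT : T.card < n) :
    Submodule.span ℝ (T : Set (Fin n → ℝ)) ≠ ⊤ := by
  intro h
  have h1 := finrank_span_finset_le_card (R := ℝ) T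
  rw [Set.finrank, h, finrank_top, Module.finrank_fin_fun] at h1
  omega

/-! ### Maximal cones and walls of a complete fan -/

namespace SmoothFan

variable {n : ℕ} {F : SmoothFan n}

theorem card_le {s : Finset (Fin n → ℤ)} (hs : s ∈ F.cones) : s.card ≤ n := by
  classical
  obtain ⟨b, hb⟩ := F.smooth s hs
  have hsub : s ⊆ Finset.univ.image b := fun u hu => by
    obtain ⟨i, rfl⟩ := hb hu
    exact Finset.mem_image_of_mem _ (Finset.mem_univ i)
  exact (Finset.card_le_card hsub).trans (Finset.card_image_le.trans (by simp))

/-- The maximal cones of a complete fan cover the space. -/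
theorem IsComplete.exists_mem_realCone (hF : F.IsComplete) (x : Fin n → ℝ) :
    ∃ s ∈ F.cones, s.card = n ∧ x ∈ realCone s := by
  classical
  by_contra! h
  -- The complement of the maximal cones is open. If nonempty, it has a point off the spans of all
  -- smaller cones, hence in no cone at all.
  let U : Set (Fin n → ℝ) := ⋂ s ∈ F.cones.filter (fun s => s.card = n), (realCone s : Set _)ᶜ
  have hU : IsOpen U := isOpen_biInter_finset fun s hs =>
    (isClosed_realCone (F.smooth s (Finset.mem_filter.1 hs).1)).isOpen_compl
  have hxU : x ∈ U := by
    simp only [U, Set.mem_iInter, Finset.mem_filter]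
    exact fun s hs => h s hs.1 hs.2
  obtain ⟨y, hyU, hy⟩ := exists_mem_forall_notMem_of_isOpen
    (F.cones.filter fun s => s.card ≠ n)
    (fun s => Submodule.span ℝ (latticeVec '' (s : Set (Fin n → ℤ)))) (fun s hs => by
      obtain ⟨hs, hne⟩ := Finset.mem_filter.1 hs
      rw [← Finset.coe_image]
      exact span_ne_top_of_card_lt _
        (Finset.card_image_le.trans_lt (lt_of_le_of_ne (F.card_le hs) hne))) hU ⟨x, hxU⟩
  obtain ⟨s, hs, hys⟩ := hF y
  by_cases hn : s.card = n
  · simp only [U, Set.mem_iInter, Finset.mem_filter] at hyU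
    exact hyU s ⟨hs, hn⟩ hys
  · exact hy s (Finset.mem_filter.2 ⟨hs, hn⟩) (realCone_subset_span s hys)

theorem exists_isOpen_subset_realCone {s : Finset (Fin n → ℤ)} (hs : s ∈ F.cones)
    (hn : s.card = n) : ∃ U : Set (Fin n → ℝ), IsOpen U ∧ U.Nonempty ∧ ∀ x ∈ U, x ∈ realCone s := by
  obtain ⟨b, hb, hb'⟩ := exists_basis_of_card_eq (F.smooth s hs) hn
  refine ⟨⋂ i, {x | 0 < latticeVec (dualVec b i) ⬝ᵥ x},
    isOpen_iInter_of_finite fun i => isOpen_lt continuous_const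
      (Continuous.dotProduct continuous_const continuous_id), ⟨∑ j, latticeVec (b j), ?_⟩, ?_⟩
  · rw [Set.mem_iInter]
    intro i
    simp [dotProduct_sum, latticeVec_dotProduct, dualVec_dotProduct]
  · intro x hx
    rw [Set.mem_iInter] at hx
    exact (mem_realCone_iff_of_basis hb' hb x).2 fun i => (hx i).le

/-- A quantity attached to the maximal cones of a complete fan that does not change across walls is
constant. -/
theorem IsComplete.eq_of_forall_isWall (hF : F.IsComplete) {α : Type*}
    (f : {s // s ∈ F.cones} → α) (hf : ∀ τ σ σ', F.IsWall τ σ σ' → f σ = f σ')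
    {σ σ' : {s // s ∈ F.cones}} (hσ : σ.1.card = n) (hσ' : σ'.1.card = n) : f σ = f σ' := by
  classical
  -- `T` holds the cones of codimension at least two; a segment from the interior of `σ` to that of
  -- `σ'` is chosen to miss them.
  let T := F.cones.filter fun s => s.card + 1 < n
  obtain ⟨U, hUo, hUn, hU⟩ := exists_isOpen_subset_realCone σ.2 hσ
  obtain ⟨U', hUo', hUn', hU'⟩ := exists_isOpen_subset_realCone σ'.2 hσ'
  obtain ⟨x, hxU, hx⟩ := exists_mem_forall_notMem_of_isOpen T
    (fun s => Submodule.span ℝ (latticeVec '' (s : Set (Fin n → ℤ)))) (fun s hs => by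
      obtain ⟨-, hs⟩ := Finset.mem_filter.1 hs
      rw [← Finset.coe_image]
      exact span_ne_top_of_card_lt _ (Finset.card_image_le.trans_lt (by omega))) hUo hUn
  -- Adjoining `x` raises the dimension by at most one, so these spans are still proper.
  obtain ⟨y, hyU, hy⟩ := exists_mem_forall_notMem_of_isOpen T
    (fun s => Submodule.span ℝ (insert x (latticeVec '' (s : Set (Fin n → ℤ))))) (fun s hs => by
      obtain ⟨-, hs⟩ := Finset.mem_filter.1 hs
      rw [← Finset.coe_image, ← Finset.coe_insert]
      refine span_ne_top_of_card_lt _ ((Finset.card_insert_le _ _).trans_lt ?_)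
      have := Finset.card_image_le (s := s) (f := latticeVec)
      omega) hUo' hUn'
  let z : Set.Icc (0 : ℝ) 1 → (Fin n → ℝ) := fun r => x + r.1 • (y - x)
  have hz : Continuous z := by fun_prop
  have hzT : ∀ r, ∀ s ∈ T, z r ∉ Submodule.span ℝ (latticeVec '' (s : Set (Fin n → ℤ))) := by
    intro r s hs hmem
    by_cases hr : r.1 = 0
    · refine hx s hs ?_
      simpa [z, hr] using hmem
    · refine hy s hs ?_
      -- Beyond the starting point, `y` lies on the line through `x` and `z r`, so a bad `z r` would
      -- put `y` in an excluded span.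
      have h1 : y = r.1⁻¹ • (z r) + (1 - r.1⁻¹) • x := by
        simp only [z, smul_add, smul_smul, inv_mul_cancel₀ hr, one_smul, sub_smul]
        abel
      rw [h1]
      exact add_mem (Submodule.smul_mem _ _ (Submodule.span_mono (Set.subset_insert _ _) hmem))
        (Submodule.smul_mem _ _ (Submodule.subset_span (Set.mem_insert _ _)))
  -- Distinct maximal cones sharing a point of the segment meet in a cone of codimension one, that
  -- is, in a wall.
  have huniq : ∀ r, ∀ s t : {s // s ∈ F.cones}, s.1.card = n → t.1.card = n →
      z r ∈ realCone s.1 → z r ∈ realCone t.1 → f s = f t := by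
    intro r s t hs ht hrs hrt
    by_cases hst : s = t
    · rw [hst]
    let τ : {s // s ∈ F.cones} := ⟨s.1 ∩ t.1, F.face_mem _ s.2 _ Finset.inter_subset_left⟩
    have hmem : z r ∈ realCone τ.1 := by
      rw [← F.inter_eq s.1 s.2 t.1 t.2]
      exact ⟨hrs, hrt⟩
    have h1 : ¬ τ.1.card + 1 < n := fun h =>
      hzT r τ.1 (Finset.mem_filter.2 ⟨τ.2, h⟩) (realCone_subset_span _ hmem)
    have h2 : τ.1.card < n := by
      refine lt_of_le_of_ne (F.card_le τ.2) fun h => hst (Subtype.ext ?_)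
      have e1 : s.1 ∩ t.1 = s.1 :=
        Finset.eq_of_subset_of_card_le Finset.inter_subset_left (hs.trans h.symm).le
      have e2 : s.1 ∩ t.1 = t.1 :=
        Finset.eq_of_subset_of_card_le Finset.inter_subset_right (ht.trans h.symm).le
      exact e1.symm.trans e2
    exact hf τ s t ⟨by omega, hs, ht, hst, Finset.inter_subset_left, Finset.inter_subset_right⟩
  choose c hc hcn hcz using fun r => hF.exists_mem_realCone (z r)
  let G : Set.Icc (0 : ℝ) 1 → α := fun r => f ⟨c r, hc r⟩
  have hG : IsLocallyConstant G := by
    rw [IsLocallyConstant.iff_eventually_eq]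
    intro r
    -- Cones are closed, so nearby points lie only in cones that already contain `z r`.
    have h1 : ∀ᶠ r' in nhds r, ∀ s ∈ F.cones, z r ∉ realCone s → z r' ∉ realCone s := by
      rw [Filter.eventually_all_finset]
      intro s hs
      by_cases h : z r ∈ realCone s
      · exact Filter.Eventually.of_forall fun _ h' => absurd h h'
      · have : {r' | z r' ∉ realCone s} ∈ nhds r :=
          ((isClosed_realCone (F.smooth s hs)).isOpen_compl.preimage hz).mem_nhds h
        filter_upwards [this] with r' h' _ using h'
    filter_upwards [h1] with r' hr'
    refine huniq r _ _ (hcn r') (hcn r) ?_ (hcz r)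
    by_contra hcon
    exact hr' _ (hc r') hcon (hcz r')
  have h01 : G ⟨0, by simp⟩ = G ⟨1, by simp⟩ := hG.apply_eq_of_preconnectedSpace _ _
  have h0 : f σ = G ⟨0, by simp⟩ :=
    huniq ⟨0, by simp⟩ _ _ hσ (hcn _) (by simpa [z] using hU x hxU) (hcz _)
  have h1 : f σ' = G ⟨1, by simp⟩ :=
    huniq ⟨1, by simp⟩ _ _ hσ' (hcn _) (by simpa [z] using hU' y hyU) (hcz _)
  rw [h0, h1, h01]

/-- The geometry of a wall: its two sides lie on opposite sides of the hyperplane that it spans, at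
lattice distance one. -/
theorem IsWall.exists_normal {τ σ σ' : {s // s ∈ F.cones}} (h : F.IsWall τ σ σ') :
    ∃ v v' δ : Fin n → ℤ, σ.1 = insert v τ.1 ∧ σ'.1 = insert v' τ.1 ∧
      (∀ u ∈ τ.1, δ ⬝ᵥ u = 0) ∧ δ ⬝ᵥ v' = 1 ∧ δ ⬝ᵥ v = -1 ∧
      ∀ p : Fin n → ℤ, (∀ u ∈ τ.1, p ⬝ᵥ u = 0) → p = (p ⬝ᵥ v') • δ := by
  classical
  -- On each side, the dual vector of the extra generator spans the lattice of normals to `τ`.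
  have side : ∀ s : {s // s ∈ F.cones}, τ.1 ⊆ s.1 → s.1.card = n →
      ∃ (b : Module.Basis (Fin n) ℤ (Fin n → ℤ)) (i : Fin n), (∀ i, b i ∈ s.1) ∧
        (∀ u ∈ s.1, ∃ i, b i = u) ∧ s.1 = insert (b i) τ.1 ∧
        (∀ u ∈ τ.1, dualVec b i ⬝ᵥ u = 0) ∧
        ∀ p : Fin n → ℤ, (∀ u ∈ τ.1, p ⬝ᵥ u = 0) → p = (p ⬝ᵥ b i) • dualVec b i := by
    intro s hτ hs
    obtain ⟨b, hb, hb'⟩ := exists_basis_of_card_eq (F.smooth s.1 s.2) hs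
    obtain ⟨v, hv⟩ := Finset.exists_eq_insert_iff.2 ⟨hτ, by rw [h.card_wall, hs]⟩ 
    obtain ⟨hv, hvs⟩ := hv
    obtain ⟨i, rfl⟩ := hb' v (by rw [← hvs]; exact Finset.mem_insert_self _ _)
    have hbτ : ∀ j, j ≠ i → b j ∈ τ.1 := fun j hj => by
      have := hb j
      rw [← hvs, Finset.mem_insert] at this
      exact this.resolve_left fun e => hj (b.injective e)
    refine ⟨b, i, hb, hb', hvs.symm, fun u hu => ?_, fun p hp => ?_⟩
    · obtain ⟨j, rfl⟩ := hb' u (hτ hu)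
      rw [dualVec_dotProduct, if_neg]
      rintro rfl
      exact hv hu
    · refine eq_of_forall_dotProduct_basis_eq b fun j => ?_
      rw [smul_dotProduct, dualVec_dotProduct]
      split_ifs with hj
      · rw [hj]; simp
      · rw [hp _ (hbτ j hj)]; simp
  obtain ⟨b, i, hb, hb', hσ, hδτ, hp⟩ := side σ h.le_left h.card_left
  obtain ⟨b', i', hc, hc', hσ', hδτ', hp'⟩ := side σ' h.le_right h.card_right
  refine ⟨b i, b' i', dualVec b' i', hσ, hσ', hδτ', ?_, ?_, hp'⟩
  · rw [dualVec_dotProduct, if_pos rfl]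
  -- The two normals generate the same rank-one lattice, so they agree up to sign.
  have hunit : dualVec b' i' ⬝ᵥ b i = 1 ∨ dualVec b' i' ⬝ᵥ b i = -1 := by
    rw [← Int.isUnit_iff]
    have h1 := congrArg (fun q => q ⬝ᵥ b i) (hp' (dualVec b i) hδτ)
    simp only [smul_dotProduct, dualVec_dotProduct, if_true, smul_eq_mul] at h1
    exact IsUnit.of_mul_eq_one _ ((mul_comm _ _).trans h1.symm)
  refine hunit.resolve_left fun h1 => ?_
  -- With the sign +1, shifting `b i` far along the interior of `τ` gives a point of both cones
  -- outside `τ`, against `F.inter_eq`. `N` dominates every coordinate of `b i` in the other basis.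
  let N : ℤ := ∑ j, |dualVec b' j ⬝ᵥ b i|
  let w : Fin n → ℤ := b i + N • ∑ u ∈ τ.1, u
  have hN : 0 ≤ N := Finset.sum_nonneg fun _ _ => abs_nonneg _
  have hdot : ∀ q : Fin n → ℤ, q ⬝ᵥ w = q ⬝ᵥ b i + N * ∑ u ∈ τ.1, q ⬝ᵥ u := fun q => by
    rw [dotProduct_add, dotProduct_smul, dotProduct_sum, smul_eq_mul]
  have hnn : ∀ (e : Module.Basis (Fin n) ℤ (Fin n → ℤ)) (j : Fin n),
      (∀ u ∈ τ.1, ∃ i, e i = u) → ∀ u ∈ τ.1, 0 ≤ dualVec e j ⬝ᵥ u := by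
    intro e j he u hu
    obtain ⟨l, rfl⟩ := he u hu
    rw [dualVec_dotProduct]
    split_ifs <;> simp
  have hwσ : latticeVec w ∈ realCone σ.1 := by
    rw [mem_realCone_iff_of_basis hb' hb]
    intro j
    rw [latticeVec_dotProduct, Int.cast_nonneg_iff, hdot]
    refine add_nonneg ?_ (mul_nonneg hN (Finset.sum_nonneg
      (hnn b j fun u hu => hb' u (h.le_left hu))))
    rw [dualVec_dotProduct]
    split_ifs <;> simp
  have hwσ' : latticeVec w ∈ realCone σ'.1 := by
    rw [mem_realCone_iff_of_basis hc' hc]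
    intro j
    rw [latticeVec_dotProduct, Int.cast_nonneg_iff, hdot]
    by_cases hj : j = i'
    · rw [hj, h1, Finset.sum_eq_zero hδτ']
      simp
    · have hjτ : b' j ∈ τ.1 := by
        have := hc j
        rw [hσ', Finset.mem_insert] at this
        exact this.resolve_left fun e => hj (b'.injective e)
      have h3 := Finset.single_le_sum (hnn b' j fun u hu => hc' u (h.le_right hu)) hjτ
      rw [dualVec_dotProduct, if_pos rfl] at h3
      have h4 : |dualVec b' j ⬝ᵥ b i| ≤ N :=
        Finset.single_le_sum (f := fun j => |dualVec b' j ⬝ᵥ b i|) (fun _ _ => abs_nonneg _)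
          (Finset.mem_univ j)
      nlinarith [neg_abs_le (dualVec b' j ⬝ᵥ b i)]
  have hinter : σ.1 ∩ σ'.1 = τ.1 := by
    refine Finset.Subset.antisymm (fun u hu => ?_) (Finset.subset_inter h.le_left h.le_right)
    obtain ⟨hu1, hu2⟩ := Finset.mem_inter.1 hu
    rw [hσ, Finset.mem_insert] at hu1
    rw [hσ', Finset.mem_insert] at hu2
    by_contra hne
    refine h.ne (Subtype.ext ?_)
    rw [hσ, hσ', ← hu1.resolve_right hne, ← hu2.resolve_right hne]
  have hwτ : latticeVec w ∈ realCone τ.1 := by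
    rw [← hinter, ← F.inter_eq _ σ.2 _ σ'.2]
    exact ⟨hwσ, hwσ'⟩
  have h2 : latticeVec (dualVec b' i') ⬝ᵥ latticeVec w = 0 := by
    refine ((mem_realCone_iff (fun u hu => hc' u (h.le_right hu)) _).1 hwτ).2 i' fun hmem => ?_
    have := hδτ' _ hmem
    rw [dualVec_dotProduct, if_pos rfl] at this
    exact one_ne_zero this
  rw [latticeVec_dotProduct, Int.cast_eq_zero, hdot, h1, Finset.sum_eq_zero hδτ'] at h2
  simp at h2

end SmoothFan

/-! ### Consequences of ampleness -/

namespace SmoothFan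

variable {n : ℕ} {F : SmoothFan n} {k : Type u} [Field k]

theorem twistedIdeal_top (I : (F.toricVariety k).IdealSheafData) (d : ℕ)
    (s : {s // s ∈ F.cones}) : twistedIdeal ⊤ I d s = sheafO I d s := by
  rw [twistedIdeal, idealOn_top, IsLocalization.coeSubmodule_top, one_mul]

/-- The local equations of an ample divisor at the fixed points are points of the polytope. -/
theorem IsAmple.dotProduct_le {I : (F.toricVariety k).IdealSheafData} (hI : IsAmple I)
    {a : (Fin n → ℤ) → ℤ} (ha : IsLinearlyEquivalent I a) {σ : {s // s ∈ F.cones}}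
    (hσ : σ.1.card = n) {m : Fin n → ℤ} (hm : ∀ u ∈ σ.1, m ⬝ᵥ u = a u) {u : Fin n → ℤ}
    (hu : {u} ∈ F.cones) : m ⬝ᵥ u ≤ a u := by
  classical
  obtain ⟨g, hg⟩ := ha
  obtain ⟨d₀, hd₀⟩ := hI ⊤
  -- A positive degree is needed: only then does a violated inequality for `m` forbid the exponent
  -- -d m on the chart of the ray `u`.
  let d := d₀ + 1
  let p₀ : Fin n → ℤ := -((d : ℤ) • m)
  have hp₀ : ∀ w, p₀ ⬝ᵥ w = -(d * (m ⬝ᵥ w)) := fun w => by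
    simp only [p₀, neg_dotProduct, smul_dotProduct, smul_eq_mul]
  by_contra! hlt
  set c := (g : TorusField k n)⁻¹ ^ d with hc
  have hc0 : c ≠ 0 := pow_ne_zero _ (inv_ne_zero g.ne_zero)
  have hmem : c * algebraMap (TorusRing k n) (TorusField k n) (character k p₀) ∈ sheafO I d σ := by
    rw [sheafO_eq_span (hg σ) d hm]
    exact Submodule.mem_span_singleton_self _
  rw [← twistedIdeal_top] at hmem
  have hspan := hd₀ d (Nat.le_succ d₀) σ hmem
  -- No global section contains `p₀`, and multiplication cannot create it: `p₀` is the apex of the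
  -- cone of exponents over U_σ, and since σ has full dimension the only regular p with p + q = p₀
  -- is 0.
  have key : ∀ x ∈ Submodule.span (chartRing k σ.1) (globalSections ⊤ I d),
      x ∈ laurentSections c ({p | ∀ u ∈ σ.1, -(d * a u) ≤ p ⬝ᵥ u} \ {p₀}) := by
    intro x hx
    induction hx using Submodule.span_induction with
    | mem x hx =>
      have h1 := hx σ
      have h2 := hx ⟨{u}, hu⟩
      rw [twistedIdeal_top, mem_sheafO_iff (hg _)] at h1 h2
      obtain ⟨h, hh, rfl⟩ := h1
      rw [mul_algebraMap_mem_laurentSections hc0] at h2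
      refine ⟨h, fun p hp => ⟨hh p hp, ?_⟩, rfl⟩
      rintro rfl
      have h3 := h2 _ hp u (Finset.mem_singleton_self u)
      rw [hp₀] at h3
      have hd : (0 : ℤ) < d := by positivity
      nlinarith
    | zero => exact zero_mem _
    | add x y _ _ hx hy => exact add_mem hx hy
    | smul r x _ hx =>
      obtain ⟨h, hh, rfl⟩ := hx
      refine ⟨r * h, fun w hw => ?_, ?_⟩
      · obtain ⟨p, hp, q, hq, rfl⟩ :=
          Finset.mem_add.1 (AddMonoidAlgebra.support_coeff_mul_subset _ _ hw)
        refine ⟨fun w hw => ?_, fun he => (hh q hq).2 ?_⟩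
        · rw [add_dotProduct]
          linarith [r.2 p hp w hw, (hh q hq).1 w hw]
        · have he : p + q = p₀ := he
          have hp0 : p = 0 := eq_of_forall_dotProduct_eq (F.smooth _ σ.2) hσ fun w hw => by
            have h1 := congrArg (fun z => z ⬝ᵥ w) he
            simp only [add_dotProduct, hp₀, hm w hw] at h1
            rw [zero_dotProduct]
            linarith [r.2 p hp w hw, (hh q hq).1 w hw]
          rw [hp0, zero_add] at he
          exact he
      · rw [chartRing_smul_def, map_mul]
        ring
  have h1 := (mul_algebraMap_mem_laurentSections hc0).1 (key _ hspan) p₀ (by simp [character])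
  exact h1.2 rfl

/-! ### The Čech complex of the curve of a wall -/

/-- `Z` holds the exponents that vanish on the curve. Modulo vanishing sections a cocycle is
determined by its coefficients off `Z`, where its two components agree, so the characters in `B`
give a basis. -/
theorem finrank_cechH0 {I : (F.toricVariety k).IdealSheafData} {d : ℕ}
    {τ σ σ' : {s // s ∈ F.cones}} {c : TorusField k n} (hc : c ≠ 0)
    {S S' T Z : Set (Fin n → ℤ)} {B : Finset (Fin n → ℤ)}
    (hσ : sectionsO I d σ = laurentSections c S) (hσ' : sectionsO I d σ' = laurentSections c S')
    (hτ : vanishingO I d τ τ = laurentSections c (T ∩ Z))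
    (hτσ : vanishingO I d τ σ = laurentSections c (S ∩ Z))
    (hτσ' : vanishingO I d τ σ' = laurentSections c (S' ∩ Z))
    (hB : ∀ p, p ∈ B ↔ p ∈ S ∧ p ∈ S' ∧ p ∉ Z) :
    Module.finrank k (CechH0 I d τ σ σ') = B.card := by
  classical
  set ι := algebraMap (TorusRing k n) (TorusField k n) with hι
  let Θ : (B → k) →ₗ[k] TorusField k n :=
    Fintype.linearCombination k fun p : B => c * ι (character k p.1)
  let P : (B → k) → TorusRing k n := fun v => ∑ p : B, v p • character k p.1
  have hΘ : ∀ v, Θ v = c * ι (P v) := fun v => by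
    simp only [Θ, P, Fintype.linearCombination_apply, map_sum, Finset.mul_sum]
    refine Finset.sum_congr rfl fun p _ => ?_
    rw [Algebra.smul_def (v p) (character k p.1), Algebra.smul_def, map_mul, hι,
      ← IsScalarTower.algebraMap_apply]
    ring
  have hP : ∀ v q, (P v).coeff q = if h : q ∈ B then v ⟨q, h⟩ else 0 := by
    intro v q
    have h1 : (P v).coeff q = ∑ p : B, if p.1 = q then v p else 0 := by
      simp [P, character, Finsupp.single_apply]
    rw [h1]
    split_ifs with h
    · rw [Finset.sum_eq_single ⟨q, h⟩ (fun p _ hp => if_neg fun e => hp (Subtype.ext e))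
        (fun h => absurd (Finset.mem_univ _) h), if_pos rfl]
    · exact Finset.sum_eq_zero fun p _ => if_neg fun e : p.1 = q => h (e ▸ p.2)
  have hPB : ∀ v q, q ∈ (P v).coeff.support → q ∈ B := fun v q hq => by
    by_contra h
    rw [Finsupp.mem_support_iff, hP, dif_neg h] at hq
    exact hq rfl
  let Θ₂ : (B → k) →ₗ[k] cechCocycles I d τ σ σ' :=
    LinearMap.codRestrict _ (LinearMap.prod Θ Θ) fun v => by
      refine ⟨⟨?_, ?_⟩, ?_⟩
      · change Θ v ∈ sectionsO I d σ
        rw [hσ, hΘ]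
        exact ⟨_, fun p hp => ((hB p).1 (hPB v p hp)).1, rfl⟩
      · change Θ v ∈ sectionsO I d σ'
        rw [hσ', hΘ]
        exact ⟨_, fun p hp => ((hB p).1 (hPB v p hp)).2.1, rfl⟩
      · change Θ v - Θ v ∈ vanishingO I d τ τ
        rw [sub_self]
        exact zero_mem _
  let Ψ : (B → k) →ₗ[k] CechH0 I d τ σ σ' := (Submodule.mkQ _).comp Θ₂
  have hinj : Function.Injective Ψ := by
    rw [← LinearMap.ker_eq_bot, LinearMap.ker_eq_bot']
    intro v hv
    have hv : Submodule.Quotient.mk (Θ₂ v) = 0 := hv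
    rw [Submodule.Quotient.mk_eq_zero] at hv
    have h1 : Θ v ∈ vanishingO I d τ σ := hv.1
    rw [hτσ, hΘ, mul_algebraMap_mem_laurentSections hc] at h1
    ext p
    by_contra hne
    have hp : p.1 ∈ (P v).coeff.support := by
      rw [Finsupp.mem_support_iff, hP, dif_pos p.2]
      exact hne
    exact ((hB p.1).1 p.2).2.2 (h1 _ hp).2
  have hsurj : Function.Surjective Ψ := by
    intro y
    obtain ⟨⟨⟨x, x'⟩, ⟨hx, hx'⟩, hxx'⟩, rfl⟩ := Submodule.Quotient.mk_surjective _ y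
    have h1 : x ∈ laurentSections c S := hσ ▸ hx
    have h2 : x' ∈ laurentSections c S' := hσ' ▸ hx'
    obtain ⟨h, hh, rfl⟩ := h1
    obtain ⟨h', hh', rfl⟩ := h2
    replace hxx' : c * ι h - c * ι h' ∈ vanishingO I d τ τ := hxx'
    rw [hτ, ← mul_sub, ← map_sub, mul_algebraMap_mem_laurentSections hc] at hxx'
    have hZ : ∀ p, p ∉ Z → h.coeff p = h'.coeff p := fun p hp => by
      by_contra hne
      refine hp (hxx' p ?_).2
      rw [Finsupp.mem_support_iff, AddMonoidAlgebra.coeff_sub, Finsupp.sub_apply]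
      exact sub_ne_zero.2 hne
    have hmem : ∀ p, p ∉ Z → h.coeff p ≠ 0 → p ∈ B := fun p hp hne =>
      (hB p).2 ⟨hh p (Finsupp.mem_support_iff.2 hne),
        hh' p (Finsupp.mem_support_iff.2 (hZ p hp ▸ hne)), hp⟩
    let v : B → k := fun p => h.coeff p.1
    have hPv : ∀ p, p ∉ Z → (P v).coeff p = h.coeff p := fun p hp => by
      rw [hP]
      split_ifs with hpB
      · rfl
      · by_contra hne
        exact hpB (hmem p hp (Ne.symm hne))
    have hvan : ∀ (f : TorusRing k n) (R : Set (Fin n → ℤ)), (∀ p ∈ B, p ∈ R) →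
        (∀ p ∈ f.coeff.support, p ∈ R) → (∀ p, p ∉ Z → h.coeff p = f.coeff p) →
        Θ v - c * ι f ∈ laurentSections c (R ∩ Z) := by
      intro f R hBR hfR hfZ
      rw [hΘ, ← mul_sub, ← map_sub, mul_algebraMap_mem_laurentSections hc]
      intro p hp
      rw [AddMonoidAlgebra.coeff_sub] at hp
      refine ⟨?_, ?_⟩
      · rcases Finset.mem_union.1 (Finsupp.support_sub hp) with h1 | h1
        · exact hBR p (hPB v p h1)
        · exact hfR p h1
      · by_contra hpZ
        rw [Finsupp.mem_support_iff, Finsupp.sub_apply, hPv p hpZ, hfZ p hpZ, sub_self] at hp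
        exact hp rfl
    refine ⟨v, (Submodule.Quotient.eq _).2 ⟨?_, ?_⟩⟩
    · change Θ v - c * ι h ∈ vanishingO I d τ σ
      rw [hτσ]
      exact hvan h S (fun p hp => ((hB p).1 hp).1) hh fun _ _ => rfl
    · change Θ v - c * ι h' ∈ vanishingO I d τ σ'
      rw [hτσ']
      exact hvan h' S' (fun p hp => ((hB p).1 hp).2.1) hh' hZ
  rw [← (LinearEquiv.ofBijective Ψ ⟨hinj, hsurj⟩).finrank_eq, Module.finrank_fintype_fun_eq_card,
    Fintype.card_coe]

/-- Each monomial over U_τ extends to one of the two charts or vanishes on the curve, so every Čech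
cochain on the overlap is a coboundary. -/
theorem finrank_cechH1 {I : (F.toricVariety k).IdealSheafData} {d : ℕ}
    {τ σ σ' : {s // s ∈ F.cones}} {c : TorusField k n}
    {S S' T Z : Set (Fin n → ℤ)}
    (hσ : sectionsO I d σ = laurentSections c S) (hσ' : sectionsO I d σ' = laurentSections c S')
    (hτ : sectionsO I d τ = laurentSections c T)
    (hττ : vanishingO I d τ τ = laurentSections c (T ∩ Z))
    (hT : ∀ p ∈ T, p ∈ S ∨ p ∈ S' ∨ p ∈ Z) :
    Module.finrank k (CechH1 I d τ σ σ') = 0 := by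
  have hle : sectionsO I d τ ≤ sectionsO I d σ ⊔ sectionsO I d σ' ⊔ vanishingO I d τ τ := by
    rw [hσ, hσ', hτ, hττ]
    rintro _ ⟨h, hh, rfl⟩
    rw [← AddMonoidAlgebra.sum_coeff_single h, Finsupp.sum, map_sum, Finset.mul_sum]
    refine sum_mem fun p hp => ?_
    have hsingle : ∀ R : Set (Fin n → ℤ), p ∈ R →
        c * algebraMap (TorusRing k n) (TorusField k n) (AddMonoidAlgebra.single p (h.coeff p)) ∈
          laurentSections c R := fun R hR => ⟨_, fun q hq => by
      have hq' : q ∈ (Finsupp.single p (h.coeff p)).support := hq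
      rwa [Finset.mem_singleton.1 (Finsupp.support_single_subset hq')], rfl⟩
    rcases hT p (hh p hp) with h1 | h1 | h1
    · exact Submodule.mem_sup_left (Submodule.mem_sup_left (hsingle _ h1))
    · exact Submodule.mem_sup_left (Submodule.mem_sup_right (hsingle _ h1))
    · exact Submodule.mem_sup_right (hsingle _ ⟨hh p hp, h1⟩)
  have : Subsingleton (CechH1 I d τ σ σ') := by
    rw [Submodule.Quotient.subsingleton_iff, Submodule.submoduleOf_eq_top]
    exact hle
  exact Module.finrank_zero_of_subsingleton

/-- The exponents that do not vanish on the curve form the line -d m - tδ. They are regular on U_σ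
for t ≥ 0 and on U_σ' for t ≤ dκ, as on a projective line in degree dκ. Since dκ ≥ 0 the two
half-lines cover all t, so H¹ = 0. -/
theorem eulerChar_eq {I : (F.toricVariety k).IdealSheafData} {a : (Fin n → ℤ) → ℤ}
    (ha : IsLinearlyEquivalent I a) {τ σ σ' : {s // s ∈ F.cones}} (hw : F.IsWall τ σ σ')
    {v v' δ m m' : Fin n → ℤ} (hσ : σ.1 = insert v τ.1) (hσ' : σ'.1 = insert v' τ.1)
    (hδ : ∀ u ∈ τ.1, δ ⬝ᵥ u = 0) (hv' : δ ⬝ᵥ v' = 1) (hv : δ ⬝ᵥ v = -1)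
    (hp : ∀ p : Fin n → ℤ, (∀ u ∈ τ.1, p ⬝ᵥ u = 0) → p = (p ⬝ᵥ v') • δ)
    (hm : ∀ u ∈ σ.1, m ⬝ᵥ u = a u) (hm' : ∀ u ∈ σ'.1, m' ⬝ᵥ u = a u) {κ : ℤ}
    (hκ : m' - m = κ • δ) (hκ0 : 0 ≤ κ) (d : ℕ) :
    eulerChar I d τ σ σ' = d * κ + 1 := by
  classical
  obtain ⟨g, hg⟩ := ha
  have hc0 : (g : TorusField k n)⁻¹ ^ d ≠ 0 := pow_ne_zero _ (inv_ne_zero g.ne_zero)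
  let Z : Set (Fin n → ℤ) := {p | ∃ u ∈ τ.1, p ⬝ᵥ u ≠ -(d * a u)}
  let q : ℤ → (Fin n → ℤ) := fun t => -((d : ℤ) • m) - t • δ
  have hq : ∀ t u, q t ⬝ᵥ u = -(d * (m ⬝ᵥ u)) - t * (δ ⬝ᵥ u) := fun t u => by
    simp only [q, sub_dotProduct, neg_dotProduct, smul_dotProduct, smul_eq_mul]
  have hvσ : m ⬝ᵥ v = a v := hm v (by rw [hσ]; exact Finset.mem_insert_self _ _)
  have hvσ' : m' ⬝ᵥ v' = a v' := hm' v' (by rw [hσ']; exact Finset.mem_insert_self _ _)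
  have hmv' : m ⬝ᵥ v' = a v' - κ := by
    have := congrArg (fun z => z ⬝ᵥ v') hκ
    simp only [sub_dotProduct, smul_dotProduct, hv', hvσ', smul_eq_mul, mul_one] at this
    linarith
  have hZ : ∀ p, p ∉ Z → ∃ t, p = q t := by
    intro p hpZ
    simp only [Z, Set.mem_ofPred_eq, not_exists, not_and, not_not] at hpZ
    have := hp (p + (d : ℤ) • m) fun u hu => by
      rw [add_dotProduct, smul_dotProduct, hpZ u hu, hm u (hw.le_left hu), smul_eq_mul]
      ring
    refine ⟨-((p + (d : ℤ) • m) ⬝ᵥ v'), ?_⟩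
    simp only [q]
    rw [neg_smul, ← this]
    abel
  have hqτ : ∀ t, ∀ u ∈ τ.1, q t ⬝ᵥ u = -(d * a u) := fun t u hu => by
    rw [hq, hδ u hu, hm u (hw.le_left hu)]
    ring
  have hqZ : ∀ t, q t ∉ Z := fun t ⟨u, hu, hne⟩ => hne (hqτ t u hu)
  have hqS : ∀ t, q t ∈ {p : Fin n → ℤ | ∀ u ∈ σ.1, -(d * a u) ≤ p ⬝ᵥ u} ↔ 0 ≤ t := by
    intro t
    simp only [Set.mem_ofPred_eq, hσ, Finset.forall_mem_insert]
    rw [hq, hv, hvσ]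
    constructor
    · rintro ⟨h, -⟩
      linarith
    · exact fun h => ⟨by linarith, fun u hu => (hqτ t u hu).ge⟩
  have hqS' : ∀ t, q t ∈ {p : Fin n → ℤ | ∀ u ∈ σ'.1, -(d * a u) ≤ p ⬝ᵥ u} ↔ t ≤ d * κ := by
    intro t
    simp only [Set.mem_ofPred_eq, hσ', Finset.forall_mem_insert]
    rw [hq, hv', hmv']
    constructor
    · rintro ⟨h, -⟩
      linarith
    · exact fun h => ⟨by linarith, fun u hu => (hqτ t u hu).ge⟩
  have hqinj : Function.Injective q := fun t t' h => by
    have := congrArg (fun z => z ⬝ᵥ v') h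
    simp only [hq, hv'] at this
    linarith
  have h0 := finrank_cechH0 (τ := τ) (T := {p | ∀ u ∈ τ.1, -(d * a u) ≤ p ⬝ᵥ u}) (Z := Z)
    (B := (Finset.Icc 0 (d * κ)).image q) hc0
    (sectionsO_eq (hg σ) d) (sectionsO_eq (hg σ') d) (vanishingO_eq (hg τ) subset_rfl d)
    (vanishingO_eq (hg σ) hw.le_left d) (vanishingO_eq (hg σ') hw.le_right d) (by
      intro p
      rw [Finset.mem_image]
      constructor
      · rintro ⟨t, ht, rfl⟩
        rw [Finset.mem_Icc] at ht
        exact ⟨(hqS t).2 ht.1, (hqS' t).2 ht.2, hqZ t⟩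
      · rintro ⟨h1, h2, h3⟩
        obtain ⟨t, rfl⟩ := hZ p h3
        exact ⟨t, Finset.mem_Icc.2 ⟨(hqS t).1 h1, (hqS' t).1 h2⟩, rfl⟩)
  have h1 := finrank_cechH1 (τ := τ) (Z := Z)
    (sectionsO_eq (hg σ) d) (sectionsO_eq (hg σ') d) (sectionsO_eq (hg τ) d)
    (vanishingO_eq (hg τ) subset_rfl d) (by
      intro p _
      by_cases h3 : p ∈ Z
      · exact Or.inr (Or.inr h3)
      obtain ⟨t, rfl⟩ := hZ p h3
      rw [hqS, hqS']
      have : 0 ≤ d * κ := by positivity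
      omega)
  rw [eulerChar, h0, h1, Finset.card_image_of_injective _ hqinj, Int.card_Icc]
  have : 0 ≤ d * κ := by positivity
  omega

theorem intersectionNumber_eq {I : (F.toricVariety k).IdealSheafData} {a : (Fin n → ℤ) → ℤ}
    (ha : IsLinearlyEquivalent I a) {τ σ σ' : {s // s ∈ F.cones}} (hw : F.IsWall τ σ σ')
    {v v' δ m m' : Fin n → ℤ} (hσ : σ.1 = insert v τ.1) (hσ' : σ'.1 = insert v' τ.1)
    (hδ : ∀ u ∈ τ.1, δ ⬝ᵥ u = 0) (hv' : δ ⬝ᵥ v' = 1) (hv : δ ⬝ᵥ v = -1)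
    (hp : ∀ p : Fin n → ℤ, (∀ u ∈ τ.1, p ⬝ᵥ u = 0) → p = (p ⬝ᵥ v') • δ)
    (hm : ∀ u ∈ σ.1, m ⬝ᵥ u = a u) (hm' : ∀ u ∈ σ'.1, m' ⬝ᵥ u = a u) {κ : ℤ}
    (hκ : m' - m = κ • δ) (hκ0 : 0 ≤ κ) : intersectionNumber I τ σ σ' = κ := by
  rw [intersectionNumber, eulerChar_eq ha hw hσ hσ' hδ hv' hv hp hm hm' hκ hκ0,
    eulerChar_eq ha hw hσ hσ' hδ hv' hv hp hm hm' hκ hκ0]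
  push_cast
  ring

end SmoothFan

/-! ### The moment polytope and its support function -/

theorem eq_of_forall_dotProduct_latticeVec_eq {n : ℕ} {s : Finset (Fin n → ℤ)}
    (hs : ∃ b : Module.Basis (Fin n) ℤ (Fin n → ℤ), (s : Set (Fin n → ℤ)) ⊆ Set.range b)
    (hn : s.card = n) {x y : Fin n → ℝ} (h : ∀ u ∈ s, x ⬝ᵥ latticeVec u = y ⬝ᵥ latticeVec u) :
    x = y := by
  obtain ⟨b, hb, -⟩ := exists_basis_of_card_eq hs hn
  refine dotProduct_eq _ _ fun ξ => ?_
  rw [← sum_dualVec_dotProduct_smul b ξ, dotProduct_sum, dotProduct_sum]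
  refine Finset.sum_congr rfl fun i _ => ?_
  rw [dotProduct_smul, dotProduct_smul, h _ (hb i)]

theorem dotProduct_le_of_mem_realCone {n : ℕ} {s : Finset (Fin n → ℤ)} {x y ξ : Fin n → ℝ}
    (h : ∀ u ∈ s, x ⬝ᵥ latticeVec u ≤ y ⬝ᵥ latticeVec u) (hξ : ξ ∈ realCone s) :
    x ⬝ᵥ ξ ≤ y ⬝ᵥ ξ := by
  induction hξ using Submodule.span_induction with
  | mem z hz =>
    obtain ⟨u, hu, rfl⟩ := hz
    exact h u hu
  | zero => simp
  | add z w _ _ hz hw =>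
    rw [dotProduct_add, dotProduct_add]
    exact add_le_add hz hw
  | smul r z _ hz =>
    have hr : r • z = (r : ℝ) • z := rfl
    rw [hr, dotProduct_smul, dotProduct_smul]
    exact mul_le_mul_of_nonneg_left hz r.2

namespace SmoothFan

variable {n : ℕ} {F : SmoothFan n} {k : Type u} [Field k]

variable (F) in
/-- The polytope `{x | ⟨x, u_ρ⟩ ≤ a_ρ for all rays ρ}`. -/
def polytope (a : (Fin n → ℤ) → ℤ) : Set (Fin n → ℝ) :=
  {x | ∀ u : Fin n → ℤ, {u} ∈ F.cones → x ⬝ᵥ latticeVec u ≤ a u}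

theorem convex_polytope (a : (Fin n → ℤ) → ℤ) : Convex ℝ (F.polytope a) := by
  intro x hx y hy r t hr ht hrt u hu
  rw [add_dotProduct, smul_dotProduct, smul_dotProduct, smul_eq_mul, smul_eq_mul]
  have h1 := mul_le_mul_of_nonneg_left (hx u hu) hr
  have h2 := mul_le_mul_of_nonneg_left (hy u hu) ht
  calc _ ≤ r * (a u : ℝ) + t * a u := add_le_add h1 h2
    _ = a u := by rw [← add_mul, hrt, one_mul]

theorem singleton_mem_cones {s : Finset (Fin n → ℤ)} (hs : s ∈ F.cones) {u : Fin n → ℤ}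
    (hu : u ∈ s) : {u} ∈ F.cones :=
  F.face_mem s hs _ (Finset.singleton_subset_iff.2 hu)

section Nef

variable {a : (Fin n → ℤ) → ℤ} {m : {s // s ∈ F.cones} → Fin n → ℤ}

theorem dotProduct_le_of_mem_polytope (hm : ∀ s : {s // s ∈ F.cones}, ∀ u ∈ s.1, m s ⬝ᵥ u = a u)
    {x ξ : Fin n → ℝ} (hx : x ∈ F.polytope a) {s : {s // s ∈ F.cones}}
    (hξ : ξ ∈ realCone s.1) : x ⬝ᵥ ξ ≤ latticeVec (m s) ⬝ᵥ ξ := by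
  refine dotProduct_le_of_mem_realCone (fun u hu => ?_) hξ
  rw [latticeVec_dotProduct, hm s u hu]
  exact hx u (singleton_mem_cones s.2 hu)

/-- The inequalities of the n rays of `s` are equalities at `m s`, and their normals form a basis,
so no segment of the polytope has this point in its interior. -/
theorem mem_extremePoints_polytope (hm : ∀ s : {s // s ∈ F.cones}, ∀ u ∈ s.1, m s ⬝ᵥ u = a u)
    {s : {s // s ∈ F.cones}} (hs : s.1.card = n) (hle : latticeVec (m s) ∈ F.polytope a) :
    latticeVec (m s) ∈ (F.polytope a).extremePoints ℝ := by
  refine ⟨hle, ?_⟩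
  rintro x hx y hy ⟨r, t, hr, ht, hrt, he⟩
  refine eq_of_forall_dotProduct_latticeVec_eq (F.smooth s.1 s.2) hs fun u hu => ?_
  have h0 := congrArg (fun z => z ⬝ᵥ latticeVec u) he
  simp only [add_dotProduct, smul_dotProduct, smul_eq_mul] at h0
  have h1 := hx u (singleton_mem_cones s.2 hu)
  have h2 := hy u (singleton_mem_cones s.2 hu)
  rw [latticeVec_dotProduct, hm s u hu] at h0 ⊢
  refine le_antisymm h1 ?_
  have ht' : t = 1 - r := by linarith
  subst ht'
  nlinarith

/-- The polytope is the convex hull of the points `m s`: a functional separating another point from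
them lies in some maximal cone `s`, where `m s` already dominates the polytope. -/
theorem extremePoints_polytope_subset (hF : F.IsComplete)
    (hm : ∀ s : {s // s ∈ F.cones}, ∀ u ∈ s.1, m s ⬝ᵥ u = a u)
    (hle : ∀ s : {s // s ∈ F.cones}, s.1.card = n → latticeVec (m s) ∈ F.polytope a) :
    (F.polytope a).extremePoints ℝ ⊆ (fun s => latticeVec (m s)) '' {s | s.1.card = n} := by
  set M := (fun s => latticeVec (m s)) '' {s : {s // s ∈ F.cones} | s.1.card = n} with hM
  have hfin : M.Finite := Set.toFinite _
  have hΔ : F.polytope a = convexHull ℝ M := by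
    apply Set.Subset.antisymm
    · intro x hx
      by_contra hcon
      obtain ⟨f, c, hf, hc⟩ := geometric_hahn_banach_closed_point (convex_convexHull ℝ M)
        (hfin.isCompact_convexHull ℝ).isClosed hcon
      let ξ : Fin n → ℝ := (dotProductEquiv ℝ (Fin n)).symm f.toLinearMap
      have hξ : ∀ y, f y = y ⬝ᵥ ξ := fun y => by
        have := LinearMap.congr_fun ((dotProductEquiv ℝ (Fin n)).apply_symm_apply f.toLinearMap) y
        rw [dotProduct_comm]
        exact this.symm
      obtain ⟨s, hs, hn, hmem⟩ := hF.exists_mem_realCone ξ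
      have h1 := dotProduct_le_of_mem_polytope hm hx (s := ⟨s, hs⟩) hmem
      have h2 := hf _ (subset_convexHull ℝ M ⟨⟨s, hs⟩, hn, rfl⟩)
      rw [hξ] at h2 hc
      simp only at h2
      linarith
    · refine convexHull_min ?_ (convex_polytope a)
      rintro _ ⟨s, hs, rfl⟩
      exact hle s hs
  rw [hΔ]
  exact extremePoints_convexHull_subset

theorem supportFunction_eq (hm : ∀ s : {s // s ∈ F.cones}, ∀ u ∈ s.1, m s ⬝ᵥ u = a u)
    (hle : ∀ s : {s // s ∈ F.cones}, s.1.card = n → latticeVec (m s) ∈ F.polytope a)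
    {φ : (Fin n → ℝ) → ℝ}
    (hφ : ∀ ξ, IsGreatest ((fun a => a ⬝ᵥ ξ) '' (F.polytope a).extremePoints ℝ) (φ ξ))
    {s : {s // s ∈ F.cones}} (hs : s.1.card = n) {ξ : Fin n → ℝ} (hξ : ξ ∈ realCone s.1) :
    φ ξ = latticeVec (m s) ⬝ᵥ ξ := by
  obtain ⟨⟨x, hx, he⟩, hub⟩ := hφ ξ
  refine le_antisymm ?_ (hub ⟨_, mem_extremePoints_polytope hm hs (hle s hs), rfl⟩)
  rw [← he]
  exact dotProduct_le_of_mem_polytope hm hx.1 hξ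

end Nef

/-- The slopes `m σ` and `m σ'` agree on `τ`, so they differ by κδ with κ = a_{v'} - ⟨m σ, v'⟩.
Ampleness gives κ ≥ 0, which allows κ to be identified with the intersection number. -/
theorem supportFunction_hasIntersectionKinks {I : (F.toricVariety k).IdealSheafData}
    (hI : IsAmple I) {a : (Fin n → ℤ) → ℤ} (ha : IsLinearlyEquivalent I a)
    {m : {s // s ∈ F.cones} → Fin n → ℤ}
    (hm : ∀ s : {s // s ∈ F.cones}, ∀ u ∈ s.1, m s ⬝ᵥ u = a u) {φ : (Fin n → ℝ) → ℝ}
    (hφ : ∀ s : {s // s ∈ F.cones}, s.1.card = n → ∀ ξ ∈ realCone s.1,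
      φ ξ = latticeVec (m s) ⬝ᵥ ξ) : HasIntersectionKinks I φ := by
  refine ⟨fun s hs hn => ⟨dotProductEquiv ℝ (Fin n) (latticeVec (m ⟨s, hs⟩)),
    fun ξ hξ => hφ ⟨s, hs⟩ hn ξ hξ⟩, fun τ σ σ' hw => ?_⟩
  obtain ⟨v, v', δ, hσ, hσ', hδ, hv', hv, hp⟩ := hw.exists_normal
  have hmem : v' ∈ σ'.1 := by
    rw [hσ']
    exact Finset.mem_insert_self _ _
  have hκ := hp (m σ' - m σ) fun u hu => by
    rw [sub_dotProduct, hm _ u (hw.le_left hu), hm _ u (hw.le_right hu), sub_self]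
  have hκ0 : 0 ≤ (m σ' - m σ) ⬝ᵥ v' := by
    rw [sub_dotProduct, hm _ v' hmem]
    exact sub_nonneg.2 (hI.dotProduct_le ha hw.card_left (hm σ) (singleton_mem_cones σ'.2 hmem))
  rw [intersectionNumber_eq ha hw hσ hσ' hδ hv' hv hp (hm σ) (hm σ') hκ hκ0]
  refine ⟨dotProductEquiv ℝ (Fin n) (latticeVec (m σ)),
    dotProductEquiv ℝ (Fin n) (latticeVec (m σ')), δ, fun ξ hξ => hφ σ hw.card_left ξ hξ,
    fun ξ hξ => hφ σ' hw.card_right ξ hξ, hδ, fun t => ⟨t • v', ?_⟩, fun u hu => ?_, fun x => ?_⟩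
  · simp only [dotProduct_smul, hv', smul_eq_mul, mul_one]
  · rw [hσ', Finset.mem_insert] at hu
    rcases hu with rfl | hu
    · rw [hv']; exact zero_le_one
    · rw [hδ u hu]
  · change latticeVec (m σ') ⬝ᵥ x - latticeVec (m σ) ⬝ᵥ x = _
    rw [← sub_dotProduct, ← latticeVec_sub]
    nth_rewrite 1 [hκ]
    rw [latticeVec_smul, smul_dotProduct, smul_eq_mul]

/-! ### Uniqueness up to linear functions -/

/-- A primitive normal vector of a wall is determined by the side on which it is nonnegative. -/
theorem eq_normal_of_surjective {τ σ' : {s // s ∈ F.cones}} {v' δ δ' : Fin n → ℤ}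
    (hv' : v' ∈ σ'.1) (hp : ∀ p : Fin n → ℤ, (∀ u ∈ τ.1, p ⬝ᵥ u = 0) → p = (p ⬝ᵥ v') • δ)
    (h0 : ∀ u ∈ τ.1, δ' ⬝ᵥ u = 0) (hsurj : Function.Surjective fun u : Fin n → ℤ => δ' ⬝ᵥ u)
    (hnn : ∀ u ∈ σ'.1, 0 ≤ δ' ⬝ᵥ u) : δ' = δ := by
  have h1 := hp δ' h0
  obtain ⟨w, hw⟩ := hsurj 1
  simp only at hw
  rw [h1, smul_dotProduct, smul_eq_mul] at hw
  have h2 := Int.eq_one_or_neg_one_of_mul_eq_one hw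
  have h3 : δ' ⬝ᵥ v' = 1 := h2.resolve_right fun h => by
    have := hnn v' hv'
    omega
  rw [h1, h3, one_smul]

/-- Piecewise linear functions with the same kinks differ by a linear function. -/
theorem IsComplete.exists_linearMap_of_kinks_eq (hF : F.IsComplete) {φ ψ : (Fin n → ℝ) → ℝ}
    (hφ : F.IsPL φ) (hψ : F.IsPL ψ) {κ : ∀ _ _ _ : {s // s ∈ F.cones}, ℝ}
    (hφκ : ∀ τ σ σ', F.IsWall τ σ σ' → HasKink φ τ σ σ' (κ τ σ σ'))
    (hψκ : ∀ τ σ σ', F.IsWall τ σ σ' → HasKink ψ τ σ σ' (κ τ σ σ')) :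
    ∃ l : (Fin n → ℝ) →ₗ[ℝ] ℝ, ∀ ξ, φ ξ = ψ ξ + l ξ := by
  -- The slope of the difference matters only on maximal cones; elsewhere any linear map will do.
  have hex : ∀ s : {s // s ∈ F.cones}, ∃ l : (Fin n → ℝ) →ₗ[ℝ] ℝ, s.1.card = n →
      ∀ x ∈ realCone s.1, φ x - ψ x = l x := by
    intro s
    by_cases hn : s.1.card = n
    · obtain ⟨l, hl⟩ := hφ s.1 s.2 hn
      obtain ⟨l', hl'⟩ := hψ s.1 s.2 hn
      exact ⟨l - l', fun _ x hx => by rw [hl x hx, hl' x hx, LinearMap.sub_apply]⟩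
    · exact ⟨0, fun h => absurd h hn⟩
  choose L hL using hex
  have hwall : ∀ τ σ σ', F.IsWall τ σ σ' → L σ = L σ' := by
    intro τ σ σ' hw
    obtain ⟨v, v', δ, hσ, hσ', -, -, -, hp⟩ := hw.exists_normal
    have hmem : v' ∈ σ'.1 := by
      rw [hσ']
      exact Finset.mem_insert_self _ _
    obtain ⟨l₁, l₁', δ₁, h₁, h₁', hδ₁, hs₁, hn₁, he₁⟩ := hφκ τ σ σ' hw
    obtain ⟨l₂, l₂', δ₂, h₂, h₂', hδ₂, hs₂, hn₂, he₂⟩ := hψκ τ σ σ' hw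
    -- Both normals are the same δ, so the jumps of the two slopes cancel in the difference.
    rw [eq_normal_of_surjective hmem hp hδ₁ hs₁ hn₁] at he₁
    rw [eq_normal_of_surjective hmem hp hδ₂ hs₂ hn₂] at he₂
    have e₁ : L σ = l₁ - l₂ := linearMap_eq_of_eqOn_realCone (F.smooth _ σ.2) hw.card_left
      fun x hx => by rw [← hL σ hw.card_left x hx, h₁ x hx, h₂ x hx, LinearMap.sub_apply]
    have e₂ : L σ' = l₁' - l₂' := linearMap_eq_of_eqOn_realCone (F.smooth _ σ'.2) hw.card_right
      fun x hx => by rw [← hL σ' hw.card_right x hx, h₁' x hx, h₂' x hx, LinearMap.sub_apply]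
    rw [e₁, e₂]
    refine LinearMap.ext fun x => ?_
    rw [LinearMap.sub_apply, LinearMap.sub_apply]
    linarith [he₁ x, he₂ x]
  obtain ⟨s, hs, hsn, -⟩ := hF.exists_mem_realCone 0
  refine ⟨L ⟨s, hs⟩, fun ξ => ?_⟩
  obtain ⟨t, ht, htn, hξ⟩ := hF.exists_mem_realCone ξ
  rw [hF.eq_of_forall_isWall L hwall (σ := ⟨s, hs⟩) (σ' := ⟨t, ht⟩) hsn htn,
    ← hL ⟨t, ht⟩ htn ξ hξ]
  ring

end SmoothFan

theorem mainTheorem5 {k : Type u} [Field k] {n : ℕ} (F : SmoothFan n) (hF : F.IsComplete)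
    (H : (F.toricVariety k).IdealSheafData) (hH : SmoothFan.IsHypersurface H)
    (hample : SmoothFan.IsAmple H) :
    (∃ Δ : Set (Fin n → ℝ), SmoothFan.IsMomentPolytope H Δ) ∧
    ∀ Δ : Set (Fin n → ℝ), SmoothFan.IsMomentPolytope H Δ →
      (Δ.extremePoints ℝ).Finite ∧ (Δ.extremePoints ℝ).Nonempty ∧
      ∀ φ : (Fin n → ℝ) → ℝ,
        (∀ ξ, IsGreatest ((fun a => a ⬝ᵥ ξ) '' Δ.extremePoints ℝ) (φ ξ)) →
        SmoothFan.HasIntersectionKinks H φ ∧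
        ∀ φH : (Fin n → ℝ) → ℝ, SmoothFan.HasIntersectionKinks H φH →
          ∃ l : (Fin n → ℝ) →ₗ[ℝ] ℝ, ∀ ξ, φ ξ = φH ξ + l ξ := by
  refine ⟨?_, ?_⟩
  · obtain ⟨a, ha⟩ := hH.exists_isLinearlyEquivalent hF
    exact ⟨_, a, ha, rfl⟩
  rintro Δ ⟨a, ha, hΔ⟩
  obtain rfl : Δ = F.polytope a := hΔ
  choose m hm using fun s : {s // s ∈ F.cones} =>
    exists_dotProduct_eq_of_subset_range_basis (F.smooth s.1 s.2) a
  have hle : ∀ s : {s // s ∈ F.cones}, s.1.card = n → latticeVec (m s) ∈ F.polytope a := by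
    intro s hs u hu
    rw [latticeVec_dotProduct, Int.cast_le]
    exact hample.dotProduct_le ha hs (hm s) hu
  refine ⟨(Set.toFinite _).subset (SmoothFan.extremePoints_polytope_subset hF hm hle), ?_, ?_⟩
  · obtain ⟨s, hs, hn, -⟩ := hF.exists_mem_realCone 0
    exact ⟨_, SmoothFan.mem_extremePoints_polytope hm (s := ⟨s, hs⟩) hn (hle _ hn)⟩
  · intro φ hφ
    have hφK : SmoothFan.HasIntersectionKinks H φ :=
      SmoothFan.supportFunction_hasIntersectionKinks hample ha hm fun s hs ξ hξ =>
        SmoothFan.supportFunction_eq hm hle hφ hs hξ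
    exact ⟨hφK, fun φH hφH => hF.exists_linearMap_of_kinks_eq hφK.1 hφH.1 hφK.2 hφH.2⟩
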